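/- **Setup.** Let $n$ be even and $q\ge 2$, and consider $n$ qudits of local dimension $q$, numbered $0,\dots,n-1$ and arranged on a ring, starting in the state $|0\rangle^{\otimes n}$. The one-dimensional brickwork architecture of depth $d\ge 1$ with periodic boundary has, at each odd timestep $t\in\{1,\dots,d\}$, an entangling gate on each pair of sites $(2j,2j+1)$ and, at each even timestep, an entangling gate on each pair $(2j,2j-1 \bmod n)$, for $0\le j<n/2$. The entangling gates $V$ are independent random unitaries, each drawn from a probability measure on $\mathrm U(q^2)$ that is a unitary 2-design. Each entangling gate may be immediately preceded and immediately succeeded by any finite number of parameterized gates acting on one or both of its two sites; a parameterized gate has the form $W_l e^{-iA\theta}W_r$ with $W_l,W_r$ fixed unitaries, $A$ Hermitian, and $\theta\mapsto e^{-iA\theta}$ periodic with period $2\pi$; it has its own parameter $\theta\in[0,2\pi]$. Let $U(\boldsymbol\theta)$ be the resulting circuit. Let $M_0=I,M_1,\dots,M_{q^2-1}$ be $q\times q$ matrices with $\operatorname{tr}(M_i^\dagger M_j)=q\,\delta_{ij}$, and for $\mathbf x\in\{0,\dots,q^2-1\}^n$ put $M_{\mathbf x}=\bigotimes_i M_{\mathbf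 x_i}$ and $$g_{\mathbf x}=\mathbb E_V\,\mathbb E_{\boldsymbol\theta}\,\bigl|\langle 0^n|U(\boldsymbol\theta)^\dagger M_{\mathbf x}U(\boldsymbol\theta)|0^n\rangle\bigr|^2,$$ where $\boldsymbol\theta$ is uniform on the product of the intervals $[0,2\pi]$. Call $M_{\mathbf x}$ spatially $k$-local if all sites $i$ with $\mathbf x_i\neq 0$ lie within $k$ adjacent sites of the ring. **Claim.** There is an absolute constant $C>0$ such that for all such $q,n,d$, all such circuits, 2-designs and matrices $M_i$, all $k\ge 0$, and all $\mathbf x$ for which $M_{\mathbf x}$ is spatially $k$-local, $$g_{\mathbf x}\;\ge\;\max\bigl\{q^{-C(d+k)},\,(q+1)^{-n}\bigr\},$$ and, more specifically, $$g_{\mathbf x}\;\ge\;\max\bigl\{(q+1)^{-k}(q^2+1)^{-(d+1)},\,(q+1)^{-n}\bigr\}.$$ -/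

import Mathlib

namespace VariationalCircuit

noncomputable section

/-! ### Unitary groups, Haar measure and 2-designs -/

section Unitary

variable (ι : Type*) [Fintype ι] [DecidableEq ι]

/-- The unitary group carries its Borel sigma-algebra. -/
instance instMeasurableSpaceUnitaryGroup : MeasurableSpace (Matrix.unitaryGroup ι ℂ) :=
  borel _

instance instBorelSpaceUnitaryGroup : BorelSpace (Matrix.unitaryGroup ι ℂ) := ⟨rfl⟩

/-- The unitary group is compact. -/
instance instCompactSpaceUnitaryGroup : CompactSpace (Matrix.unitaryGroup ι ℂ) := by
  have hK : IsCompact (Set.univ.pi fun _ : ι => Set.univ.pi fun _ : ι =>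
      Metric.closedBall (0 : ℂ) 1) :=
    isCompact_univ_pi fun _ => isCompact_univ_pi fun _ => isCompact_closedBall _ _
  have hclosed : IsClosed ((Matrix.unitaryGroup ι ℂ : Set (Matrix ι ι ℂ))) := by
    have h : (Matrix.unitaryGroup ι ℂ : Set (Matrix ι ι ℂ)) =
        {A | A * star A = 1} := by
      ext A
      exact Matrix.mem_unitaryGroup_iff
    rw [h]
    exact isClosed_eq (by fun_prop) continuous_const
  have hsub : (Matrix.unitaryGroup ι ℂ : Set (Matrix ι ι ℂ)) ⊆
      (Set.univ.pi fun _ : ι => Set.univ.pi fun _ : ι => Metric.closedBall (0 : ℂ) 1) := by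
    intro A hA i _ j _
    simpa using entry_norm_bound_of_unitary hA i j
  exact isCompact_iff_compactSpace.mp (hK.of_isClosed_subset hclosed hsub)

/-- The Haar probability measure on the unitary group. -/
def haarUnitary : MeasureTheory.Measure (Matrix.unitaryGroup ι ℂ) :=
  MeasureTheory.Measure.haarMeasure ⊤

variable {ι}

/-- A probability measure on the unitary group is a *2-design* if its second moments, i.e. the
entries of `E[U ⊗ U ⊗ conj U ⊗ conj U]`, agree with those of the Haar measure. -/
structure IsTwoDesign (μ : MeasureTheory.Measure (Matrix.unitaryGroup ι ℂ)) : Prop where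
  isProbabilityMeasure : MeasureTheory.IsProbabilityMeasure μ
  moments : ∀ a a' b b' c c' e e' : ι,
    ∫ U : Matrix.unitaryGroup ι ℂ,
        (U : Matrix ι ι ℂ) a a' * (U : Matrix ι ι ℂ) b b' *
          star ((U : Matrix ι ι ℂ) c c') * star ((U : Matrix ι ι ℂ) e e') ∂μ =
      ∫ U : Matrix.unitaryGroup ι ℂ,
        (U : Matrix ι ι ℂ) a a' * (U : Matrix ι ι ℂ) b b' *
          star ((U : Matrix ι ι ℂ) c c') * star ((U : Matrix ι ι ℂ) e e') ∂(haarUnitary ι)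

end Unitary

/-! ### States and operators on `n` qudits of dimension `q` -/

/-- Operators on two qudits. -/
abbrev PairOp (q : ℕ) := Matrix (Fin q × Fin q) (Fin q × Fin q) ℂ

/-- Operators on `n` qudits, written in the computational basis. -/
abbrev Op (q n : ℕ) := Matrix (Fin n → Fin q) (Fin n → Fin q) ℂ

/-- The starting state, `n` copies of `|0⟩`. -/
def zeroKet (q n : ℕ) [NeZero q] : (Fin n → Fin q) → ℂ := Pi.single (fun _ => 0) 1

/-- The two-qudit operator `G` acting on the (ordered) pair of sites `i`, `j` and as the identity
on all other sites. -/
def onPair {q n : ℕ} (i j : Fin n) (G : PairOp q) : Op q n :=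
  Matrix.of fun s t =>
    if ∀ l, l ≠ i → l ≠ j → s l = t l then G (s i, s j) (t i, t j) else 0

/-- A family `M 0, …, M (q ^ 2 - 1)` of `q × q` matrices, orthogonal for the Hilbert–Schmidt inner
product, with `M 0` the identity and `tr ((M a)ᴴ * M b) = q δ_{a,b}`. -/
structure IsOperatorBasis {q : ℕ} [NeZero q]
    (M : Fin (q ^ 2) → Matrix (Fin q) (Fin q) ℂ) : Prop where
  zero_eq_one : M 0 = 1
  trace_eq : ∀ a b, ((M a).conjTranspose * M b).trace = if a = b then (q : ℂ) else 0

/-- `M_x`, the tensor product of the `M (x i)` over the sites `i`. -/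
def tensorOp {q n : ℕ} (M : Fin (q ^ 2) → Matrix (Fin q) (Fin q) ℂ)
    (x : Fin n → Fin (q ^ 2)) : Op q n :=
  Matrix.of fun s t => ∏ i, M (x i) (s i) (t i)

/-- `M_x` is spatially `k`-local on the ring of `n` sites: the support of `x` lies within `k`
adjacent sites `a, a + 1, …, a + k - 1` (modulo `n`). -/
def IsSpatiallyLocal {q n : ℕ} [NeZero q] (k : ℕ) (x : Fin n → Fin (q ^ 2)) : Prop :=
  ∃ a : ℕ, ∀ i : Fin n, x i ≠ 0 → ∃ r < k, (i : ℕ) = (a + r) % n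

/-! ### Parameterized gates -/

/-- A parameterized gate `W_l exp(-iAθ) W_r` on (one or both sites of) a pair of qudits, with `A`
Hermitian and `exp(-iAθ)` periodic in `θ` with period `2π`. Gates on one of the two sites are
those for which `A`, `W_l`, `W_r` act trivially on the other one. -/
structure ParamGate (q : ℕ) where
  A : PairOp q
  isHermitian : A.IsHermitian
  periodic : Function.Periodic
    (fun θ : ℝ => NormedSpace.exp (-(Complex.I * (θ : ℂ)) • A)) (2 * Real.pi)
  Wl : Matrix.unitaryGroup (Fin q × Fin q) ℂ
  Wr : Matrix.unitaryGroup (Fin q × Fin q) ℂ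

/-- The unitary implemented by a parameterized gate at parameter value `θ`. -/
def ParamGate.eval {q : ℕ} (P : ParamGate q) (θ : ℝ) : PairOp q :=
  (P.Wl : PairOp q) * NormedSpace.exp (-(Complex.I * (θ : ℂ)) • P.A) * (P.Wr : PairOp q)

/-! ### The 1D brickwork architecture with periodic boundary -/

/-- The entangling gates: the gate `(t, j)` is the `j`-th gate of timestep `t + 1`. -/
abbrev GateIdx (n d : ℕ) := Fin d × Fin (n / 2)

/-- The first site `2j` of the `j`-th gate of a layer. -/
def fstSite {n : ℕ} (j : Fin (n / 2)) : Fin n := ⟨2 * j, by omega⟩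

/-- The second site of the `j`-th gate of timestep `τ` (timesteps are numbered from `1`): it is
`2j + 1` if `τ` is odd and `2j - 1` modulo `n` if `τ` is even. -/
def sndSite {n : ℕ} (τ : ℕ) (j : Fin (n / 2)) : Fin n :=
  if Odd τ then ⟨2 * j + 1, by omega⟩
  else ⟨(2 * j + n - 1) % n, Nat.mod_lt _ (by have := j.isLt; omega)⟩

/-- The parameterized gates of an ansatz with brickwork entangling gates of depth `d` on `n` qudits:
each entangling gate is immediately preceded and succeeded by an arbitrary finite number of
parameterized gates acting on its sites. In `pre g` and `post g`, index `0` is applied first. -/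
structure BrickworkAnsatz (q n d : ℕ) where
  numPre : GateIdx n d → ℕ
  numPost : GateIdx n d → ℕ
  pre : ∀ g, Fin (numPre g) → ParamGate q
  post : ∀ g, Fin (numPost g) → ParamGate q

namespace BrickworkAnsatz

variable {q n d : ℕ}

/-- The parameters of the ansatz, one for each parameterized gate. -/
abbrev ParamIdx (𝒜 : BrickworkAnsatz q n d) :=
  (Σ g, Fin (𝒜.numPre g)) ⊕ (Σ g, Fin (𝒜.numPost g))

/-- The `j`-th entangling gate of a layer together with its surrounding parameterized gates, as an
operator on its two sites. Operators applied later stand further to the left. -/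
def block (𝒜 : BrickworkAnsatz q n d)
    (V : GateIdx n d → Matrix.unitaryGroup (Fin q × Fin q) ℂ) (θ : 𝒜.ParamIdx → ℝ)
    (g : GateIdx n d) : PairOp q :=
  (List.ofFn fun l => (𝒜.post g l).eval (θ (Sum.inr ⟨g, l⟩))).reverse.prod *
    (V g : PairOp q) *
    (List.ofFn fun l => (𝒜.pre g l).eval (θ (Sum.inl ⟨g, l⟩))).reverse.prod

/-- The layer of timestep `t + 1`. (Its blocks act on disjoint pairs of sites.) -/
def layer (𝒜 : BrickworkAnsatz q n d)
    (V : GateIdx n d → Matrix.unitaryGroup (Fin q × Fin q) ℂ) (θ : 𝒜.ParamIdx → ℝ)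
    (t : Fin d) : Op q n :=
  (List.ofFn fun j : Fin (n / 2) =>
    onPair (fstSite j) (sndSite (t + 1) j) (𝒜.block V θ (t, j))).prod

/-- The whole circuit `U(θ)`, for the realization `V` of the entangling gates. -/
def circuit (𝒜 : BrickworkAnsatz q n d)
    (V : GateIdx n d → Matrix.unitaryGroup (Fin q × Fin q) ℂ) (θ : 𝒜.ParamIdx → ℝ) : Op q n :=
  (List.ofFn fun t : Fin d => 𝒜.layer V θ t).reverse.prod

/-- The expectation value `⟨0^n| U(θ)† O U(θ) |0^n⟩`. -/
def expval [NeZero q] (𝒜 : BrickworkAnsatz q n d)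
    (V : GateIdx n d → Matrix.unitaryGroup (Fin q × Fin q) ℂ) (θ : 𝒜.ParamIdx → ℝ)
    (O : Op q n) : ℂ :=
  star (zeroKet q n) ⬝ᵥ
    (((𝒜.circuit V θ).conjTranspose * O * 𝒜.circuit V θ).mulVec (zeroKet q n))

/-- `g_x = E_V E_θ |⟨0^n| U(θ)† M_x U(θ) |0^n⟩|²`, where the entangling gates `V g` are independent
with laws `μ g` and the parameters are independent and uniform on `[0, 2π]`. -/
def gVal [NeZero q] (𝒜 : BrickworkAnsatz q n d)
    (μ : GateIdx n d → MeasureTheory.Measure (Matrix.unitaryGroup (Fin q × Fin q) ℂ))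
    (M : Fin (q ^ 2) → Matrix (Fin q) (Fin q) ℂ) (x : Fin n → Fin (q ^ 2)) : ℝ :=
  ∫ V, (∫ θ : 𝒜.ParamIdx → ℝ, ‖𝒜.expval V θ (tensorOp M x)‖ ^ 2
      ∂(MeasureTheory.Measure.pi fun _ =>
        ProbabilityTheory.cond MeasureTheory.volume (Set.Icc (0 : ℝ) (2 * Real.pi))))
    ∂(MeasureTheory.Measure.pi μ)

end BrickworkAnsatz

end

end VariationalCircuit

/-! The parameters may be frozen: at fixed θ each entangling gate sits in a block `S * V * T` with
fixed unitaries `S` and `T`, so a bound on the average over `V` that is uniform in θ suffices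
(`le_gVal`).

For a 2-design `V` in dimension N = q ^ 2, a traceless `A` with tr(Aᴴ A) = N and any linear
functional L, the mean of |L(Wᴴ A W)|² with W = S V T depends on L alone
(`IsTwoDesign.integral_norm_sq`). Written in the basis `M`, a block that meets a nonidentity pair of
factors replaces the second moment by its uniform average over the q ^ 4 - 1 nonidentity pairs, and
a block that meets the identity pair does nothing. Peeling blocks off from the last to the first
thus runs a Markov chain on the strings x (`moment_cons_of_nontrivial`).

The first timestep meets a product state and covers every site. There a nonidentity pair costs
exactly (q ^ 2 - 1) / (q ^ 4 - 1) = 1 / (q ^ 2 + 1), and an identity pair costs nothing. This gives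
at least (q ^ 2 + 1) ^ (-n / 2) ≥ (q + 1) ^ (-n) for every string, and averaging over later gates
preserves a bound valid for every string.

For local operators, the support is enclosed in an arc of 2b sites, b = ⌊k / 2⌋ + 1, that cuts no
gate of the last layer. Gates preserve such an arc, but it is misaligned with the preceding layer.
With weight 1 / (q ^ 2 + 1) the gate at its left end leaves the identity on the end site; the
support then lies in the arc translated by one, which is aligned again (`le_moment_append_shrink`,
`arc_diff_subset`). After d - 1 translations the first layer has at most b nonidentity pairs. The
total exponent is b + d - 1 = ⌊k / 2⌋ + d, and (q ^ 2 + 1) ^ (k / 2) ≤ (q + 1) ^ k finishes. -/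

namespace VariationalCircuit

noncomputable section

open MeasureTheory Matrix Kronecker

/-! ### Haar measure and the symmetries of the second-moment tensor -/

section Haar

variable {ι : Type*} [Fintype ι] [DecidableEq ι]

instance instSecondCountableTopologyUnitaryGroup :
    SecondCountableTopology (Matrix.unitaryGroup ι ℂ) :=
  haveI : SecondCountableTopology (Matrix ι ι ℂ) :=
    inferInstanceAs (SecondCountableTopology (ι → ι → ℂ))
  TopologicalSpace.Subtype.secondCountableTopology _

instance instIsHaarMeasureHaarUnitary : (haarUnitary ι).IsHaarMeasure := by
  unfold haarUnitary; infer_instance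

instance instIsProbabilityMeasureHaarUnitary : IsProbabilityMeasure (haarUnitary ι) := by
  constructor
  have := Measure.haarMeasure_self (K₀ := (⊤ : TopologicalSpace.PositiveCompacts
    (Matrix.unitaryGroup ι ℂ)))
  simpa [haarUnitary] using this

/-- Compact groups are unimodular: a right translate of the Haar measure is again a left Haar
probability measure, and there is only one. -/
instance instIsMulRightInvariantHaarUnitary : (haarUnitary ι).IsMulRightInvariant := by
  constructor
  intro g
  have : IsProbabilityMeasure (Measure.map (· * g) (haarUnitary ι)) :=
    Measure.isProbabilityMeasure_map (by fun_prop)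
  exact Measure.isHaarMeasure_eq_of_isProbabilityMeasure _ _

theorem continuous_unitaryGroup_apply (i j : ι) :
    Continuous fun V : Matrix.unitaryGroup ι ℂ => (V : Matrix ι ι ℂ) i j :=
  (continuous_apply_apply i j).comp continuous_subtype_val

theorem integrable_of_continuous_compact {X E : Type*} [TopologicalSpace X] [CompactSpace X]
    [MeasurableSpace X] [OpensMeasurableSpace X] [NormedAddCommGroup E]
    (ν : Measure X) [IsFiniteMeasure ν] {f : X → E} (hf : Continuous f) : Integrable f ν :=
  hf.integrable_of_hasCompactSupport (HasCompactSupport.of_compactSpace f)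

/-- The second moment tensor of `Vᴴ A V` for Haar random `V`. -/
def conjMoment (A : Matrix ι ι ℂ) (i j k l : ι) : ℂ :=
  ∫ V : Matrix.unitaryGroup ι ℂ, ((V : Matrix ι ι ℂ)ᴴ * A * V) i j *
    star (((V : Matrix ι ι ℂ)ᴴ * A * V) k l) ∂(haarUnitary ι)

theorem continuous_conj_apply (A : Matrix ι ι ℂ) (i j : ι) :
    Continuous fun V : Matrix.unitaryGroup ι ℂ => ((V : Matrix ι ι ℂ)ᴴ * A * V) i j := by
  have h : Continuous fun V : Matrix.unitaryGroup ι ℂ => ((V : Matrix ι ι ℂ)ᴴ * A * V) := by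
    fun_prop
  exact (continuous_apply_apply i j).comp h

theorem integrable_conj_apply_mul (A : Matrix ι ι ℂ) (i j k l : ι) :
    Integrable (fun V : Matrix.unitaryGroup ι ℂ => ((V : Matrix ι ι ℂ)ᴴ * A * V) i j *
    star (((V : Matrix ι ι ℂ)ᴴ * A * V) k l)) (haarUnitary ι) :=
  integrable_of_continuous_compact _
    ((continuous_conj_apply A i j).mul (continuous_conj_apply A k l).star)

/-- Substituting V U for V turns Vᴴ A V into its conjugate by U. Every choice of U is therefore a
linear relation on the tensor; diagonal phases, permutations and one reflection will determine it.
-/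
theorem conjMoment_eq_rotated (A : Matrix ι ι ℂ) (U : Matrix.unitaryGroup ι ℂ) (i j k l : ι) :
    conjMoment A i j k l = ∑ p : ι × ι, ∑ p' : ι × ι,
      (star ((U : Matrix ι ι ℂ) p.1 i) * (U : Matrix ι ι ℂ) p.2 j *
        ((U : Matrix ι ι ℂ) p'.1 k * star ((U : Matrix ι ι ℂ) p'.2 l))) *
        conjMoment A p.1 p.2 p'.1 p'.2 := by
  have key : ∀ (H : Matrix ι ι ℂ) (a b : ι), ((U : Matrix ι ι ℂ)ᴴ * H * U) a b =
      ∑ p : ι × ι, star ((U : Matrix ι ι ℂ) p.1 a) * (U : Matrix ι ι ℂ) p.2 b * H p.1 p.2 := by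
    intro H a b
    rw [Fintype.sum_prod_type, Finset.sum_comm]
    simp only [Matrix.mul_apply, Finset.sum_mul, Matrix.conjTranspose_apply]
    exact Finset.sum_congr rfl fun _ _ => Finset.sum_congr rfl fun _ _ => by ring
  unfold conjMoment
  rw [← integral_mul_right_eq_self _ U]
  simp only [← integral_const_mul]
  rw [show (∑ p : ι × ι, ∑ p' : ι × ι, ∫ V : Matrix.unitaryGroup ι ℂ,
      (star ((U : Matrix ι ι ℂ) p.1 i) * (U : Matrix ι ι ℂ) p.2 j *
        ((U : Matrix ι ι ℂ) p'.1 k * star ((U : Matrix ι ι ℂ) p'.2 l))) *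
        (((V : Matrix ι ι ℂ)ᴴ * A * V) p.1 p.2 *
    star (((V : Matrix ι ι ℂ)ᴴ * A * V) p'.1 p'.2)) ∂(haarUnitary ι)) =
    ∫ V : Matrix.unitaryGroup ι ℂ, ∑ p : ι × ι, ∑ p' : ι × ι,
      (star ((U : Matrix ι ι ℂ) p.1 i) * (U : Matrix ι ι ℂ) p.2 j *
        ((U : Matrix ι ι ℂ) p'.1 k * star ((U : Matrix ι ι ℂ) p'.2 l))) *
        (((V : Matrix ι ι ℂ)ᴴ * A * V) p.1 p.2 *
    star (((V : Matrix ι ι ℂ)ᴴ * A * V) p'.1 p'.2)) ∂(haarUnitary ι) from ?_]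
  · congr 1
    ext V
    have hV : ((V * U : Matrix.unitaryGroup ι ℂ) : Matrix ι ι ℂ)ᴴ * A *
        ((V * U : Matrix.unitaryGroup ι ℂ) : Matrix ι ι ℂ) =
        (U : Matrix ι ι ℂ)ᴴ * ((V : Matrix ι ι ℂ)ᴴ * A * V) * U := by
      simp [Matrix.conjTranspose_mul, Matrix.mul_assoc]
    rw [hV, key, key, star_sum, Finset.sum_mul_sum]
    refine Finset.sum_congr rfl fun _ _ => Finset.sum_congr rfl fun _ _ => ?_
    simp only [star_mul', star_star]
    ring
  · have hi : ∀ p p' : ι × ι, Integrable (fun V : Matrix.unitaryGroup ι ℂ =>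
      (star ((U : Matrix ι ι ℂ) p.1 i) * (U : Matrix ι ι ℂ) p.2 j *
        ((U : Matrix ι ι ℂ) p'.1 k * star ((U : Matrix ι ι ℂ) p'.2 l))) *
        (((V : Matrix ι ι ℂ)ᴴ * A * V) p.1 p.2 *
    star (((V : Matrix ι ι ℂ)ᴴ * A * V) p'.1 p'.2))) (haarUnitary ι) := fun p p' =>
        (integrable_conj_apply_mul A _ _ _ _).const_mul _
    rw [integral_finsetSum _ fun p _ => integrable_finsetSum _ fun p' _ => hi p p']
    refine Finset.sum_congr rfl fun p _ => ?_
    rw [integral_finsetSum _ fun p' _ => hi p p']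

/-- The diagonal unitary with entry `i` at `m` and `1` elsewhere. -/
def phaseUnitary (m : ι) : Matrix.unitaryGroup ι ℂ :=
  ⟨Matrix.diagonal (Function.update 1 m Complex.I), by
    rw [Matrix.mem_unitaryGroup_iff, Matrix.star_eq_conjTranspose, Matrix.diagonal_conjTranspose,
      Matrix.diagonal_mul_diagonal, ← Matrix.diagonal_one]
    congr 1
    ext i
    by_cases h : i = m
    · subst h; simp
    · simp [h]⟩

theorem conjMoment_phase (A : Matrix ι ι ℂ) (m i j k l : ι) :
    conjMoment A i j k l =
      (star ((Function.update 1 m Complex.I : ι → ℂ) i) *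
        (Function.update 1 m Complex.I : ι → ℂ) j *
        ((Function.update 1 m Complex.I : ι → ℂ) k *
          star ((Function.update 1 m Complex.I : ι → ℂ) l))) * conjMoment A i j k l := by
  conv_lhs => rw [conjMoment_eq_rotated A (phaseUnitary m)]
  rw [Finset.sum_eq_single (i, j), Finset.sum_eq_single (k, l)]
  · simp [phaseUnitary]
  · rintro ⟨c, d⟩ _ h
    by_cases hc : c = k
    · have hd : d ≠ l := fun hd => h (by rw [hc, hd])
      simp [phaseUnitary, Matrix.diagonal_apply_ne _ hd]
    · simp [phaseUnitary, Matrix.diagonal_apply_ne _ hc]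
  · simp
  · rintro ⟨c, d⟩ _ h
    by_cases hc : c = i
    · have hd : d ≠ j := fun hd => h (by rw [hc, hd])
      simp [phaseUnitary, Matrix.diagonal_apply_ne _ hd]
    · simp [phaseUnitary, Matrix.diagonal_apply_ne _ hc]
  · simp

/-- A phase at one index multiplies the entry by a character, which must be 1 unless the entry
vanishes. The phase is `Complex.I` and not -1 because an index occurring as i = l only would pick up
its square. -/
theorem conjMoment_eq_zero (A : Matrix ι ι ℂ) {i j k l : ι}
    (h1 : ¬ (i = j ∧ k = l)) (h2 : ¬ (i = k ∧ j = l)) : conjMoment A i j k l = 0 := by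
  have hI1 : (1 : ℂ) - Complex.I ≠ 0 := fun h => by simpa using congrArg Complex.im h
  have hI2 : (1 : ℂ) + Complex.I ≠ 0 := fun h => by simpa using congrArg Complex.im h
  by_cases hij : i = j
  · have hkl : k ≠ l := fun h => h1 ⟨hij, h⟩
    subst hij
    have h := conjMoment_phase A l i i k l
    have h3 : (Function.update 1 l Complex.I : ι → ℂ) k = 1 := by simp [hkl]
    have h4 : star ((Function.update 1 l Complex.I : ι → ℂ) i) *
        (Function.update 1 l Complex.I : ι → ℂ) i = 1 := by
      by_cases hil : i = l
      · subst hil; simp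
      · simp [hil]
    rw [h4, h3] at h
    simp only [Function.update_self, Complex.star_def, Complex.conj_I] at h
    have : (1 + Complex.I) * conjMoment A i i k l = 0 := by linear_combination h
    simpa [hI2] using this
  · by_cases hik : i = k
    · subst hik
      have hjl : j ≠ l := fun h => h2 ⟨rfl, h⟩
      have h := conjMoment_phase A j i j i l
      simp [hij, hjl.symm] at h
      have : (1 - Complex.I) * conjMoment A i j i l = 0 := by linear_combination h
      simpa [hI1] using this
    · have h := conjMoment_phase A i i j k l
      have h3 : (Function.update 1 i Complex.I : ι → ℂ) j = 1 := by simp [Ne.symm hij]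
      have h4 : (Function.update 1 i Complex.I : ι → ℂ) k = 1 := by simp [Ne.symm hik]
      rw [h3, h4] at h
      by_cases hil : i = l
      · subst hil
        simp at h
        have : (2 : ℂ) * conjMoment A i j k i = 0 := by
          linear_combination h
        simpa using this
      · simp [Ne.symm hil] at h
        have : (1 + Complex.I) * conjMoment A i j k l = 0 := by linear_combination h
        simpa [hI2] using this

/-- A permutation matrix as a unitary. -/
def permUnitary (σ : Equiv.Perm ι) : Matrix.unitaryGroup ι ℂ :=
  ⟨(1 : Matrix ι ι ℂ).submatrix id σ, by
    rw [Matrix.mem_unitaryGroup_iff, Matrix.star_eq_conjTranspose, Matrix.conjTranspose_submatrix,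
      Matrix.submatrix_mul_equiv]
    simp⟩

theorem permUnitary_apply (σ : Equiv.Perm ι) (a b : ι) :
    (permUnitary σ : Matrix ι ι ℂ) a b = if a = σ b then 1 else 0 := by
  simp [permUnitary, Matrix.one_apply]

theorem conjMoment_perm (A : Matrix ι ι ℂ) (σ : Equiv.Perm ι) (i j k l : ι) :
    conjMoment A i j k l = conjMoment A (σ i) (σ j) (σ k) (σ l) := by
  rw [conjMoment_eq_rotated A (permUnitary σ), Finset.sum_eq_single (σ i, σ j),
    Finset.sum_eq_single (σ k, σ l)]
  · simp [permUnitary_apply]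
  · rintro ⟨c, d⟩ _ h
    by_cases hc : c = σ k
    · have hd : d ≠ σ l := fun hd => h (by rw [hc, hd])
      simp [permUnitary_apply, hd]
    · simp [permUnitary_apply, hc]
  · simp
  · rintro ⟨c, d⟩ _ h
    by_cases hc : c = σ i
    · have hd : d ≠ σ j := fun hd => h (by rw [hc, hd])
      simp [permUnitary_apply, hd]
    · simp [permUnitary_apply, hc]
  · simp

omit [Fintype ι] in
theorem exists_perm_map_pair {i j i' j' : ι} (h : i ≠ j) (h' : i' ≠ j') :
    ∃ σ : Equiv.Perm ι, σ i = i' ∧ σ j = j' := by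
  refine ⟨(Equiv.swap i i').trans (Equiv.swap (Equiv.swap i i' j) j'), ?_, ?_⟩
  · have h1 : i' ≠ Equiv.swap i i' j := by
      intro e
      have := congrArg (Equiv.swap i i') e
      simp at this
      exact h this
    simp [Equiv.swap_apply_of_ne_of_ne h1 h']
  · simp

/-- The reflection `1 - (2 / N) J`, where `J` is the all-ones matrix. -/
def reflectionUnitary (hN : (Fintype.card ι : ℂ) ≠ 0) : Matrix.unitaryGroup ι ℂ :=
  ⟨Matrix.of fun i j => (if i = j then 1 else 0) - 2 / (Fintype.card ι : ℂ), by
    rw [Matrix.mem_unitaryGroup_iff, Matrix.star_eq_conjTranspose]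
    ext i j
    have hs : ∀ a b : ι, star ((if a = b then (1 : ℂ) else 0) - 2 / (Fintype.card ι : ℂ)) =
        (if a = b then 1 else 0) - 2 / (Fintype.card ι : ℂ) := by
      intro a b
      split_ifs <;> simp
    simp only [Matrix.mul_apply, Matrix.conjTranspose_apply, Matrix.of_apply, hs]
    simp only [sub_mul, mul_sub, Finset.sum_sub_distrib, ite_mul, mul_ite, mul_one, one_mul,
      mul_zero, zero_mul, Finset.sum_ite_eq, Finset.mem_univ, if_true, Finset.sum_const,
      Finset.card_univ, nsmul_eq_mul, Matrix.one_apply]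
    by_cases h : i = j
    · subst h; simp; field_simp; ring
    · simp [h]; field_simp; ring⟩

theorem sum_conjMoment_norm (A : Matrix ι ι ℂ) :
    ∑ p : ι × ι, conjMoment A p.1 p.2 p.1 p.2 = (Aᴴ * A).trace := by
  unfold conjMoment
  rw [← integral_finsetSum _ fun p _ => integrable_conj_apply_mul A _ _ _ _]
  have : ∀ V : Matrix.unitaryGroup ι ℂ, ∑ p : ι × ι, ((V : Matrix ι ι ℂ)ᴴ * A * V) p.1 p.2 *
    star (((V : Matrix ι ι ℂ)ᴴ * A * V) p.1 p.2) = (Aᴴ * A).trace := by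
    intro V
    have hV : (V : Matrix ι ι ℂ) * (V : Matrix ι ι ℂ)ᴴ = 1 := Matrix.mem_unitaryGroup_iff.mp V.2
    have h1 : ∀ H : Matrix ι ι ℂ, ∑ p : ι × ι, H p.1 p.2 * star (H p.1 p.2) =
        (Hᴴ * H).trace := by
      intro H
      rw [Matrix.trace, Fintype.sum_prod_type, Finset.sum_comm]
      simp [Matrix.mul_apply, mul_comm]
    rw [h1]
    simp only [Matrix.conjTranspose_mul, Matrix.conjTranspose_conjTranspose]
    calc ((V : Matrix ι ι ℂ)ᴴ * (Aᴴ * V) * ((V : Matrix ι ι ℂ)ᴴ * A * V)).trace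
        = ((V : Matrix ι ι ℂ)ᴴ * (Aᴴ * (V * (V : Matrix ι ι ℂ)ᴴ) * A * V)).trace := by
          simp only [Matrix.mul_assoc]
      _ = _ := by
          rw [hV, Matrix.trace_mul_comm]
          simp only [Matrix.mul_assoc, hV, Matrix.mul_one]
  rw [integral_congr_ae (Filter.Eventually.of_forall this)]
  simp

theorem sum_conjMoment_trace (A : Matrix ι ι ℂ) (hA : A.trace = 0) (i : ι) :
    ∑ j, conjMoment A i i j j = 0 := by
  unfold conjMoment
  rw [← integral_finsetSum _ fun p _ => integrable_conj_apply_mul A _ _ _ _]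
  have : ∀ V : Matrix.unitaryGroup ι ℂ, ∑ j, ((V : Matrix ι ι ℂ)ᴴ * A * V) i i *
    star (((V : Matrix ι ι ℂ)ᴴ * A * V) j j) = 0 := by
    intro V
    have hV : (V : Matrix ι ι ℂ) * (V : Matrix ι ι ℂ)ᴴ = 1 := Matrix.mem_unitaryGroup_iff.mp V.2
    rw [← Finset.mul_sum, ← star_sum]
    have : ∑ j, ((V : Matrix ι ι ℂ)ᴴ * A * V) j j = ((V : Matrix ι ι ℂ)ᴴ * A * V).trace := rfl
    rw [this, Matrix.mul_assoc, Matrix.trace_mul_comm, Matrix.mul_assoc, hV, Matrix.mul_one, hA]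
    simp
  rw [integral_congr_ae (Filter.Eventually.of_forall this)]
  simp

end Haar

/-! ### Second moments of a conjugated operator under Haar measure and 2-designs -/

section SecondMoment

variable {ι : Type*} [Fintype ι] [DecidableEq ι]

/-- Phases and permutations leave three constants α, β, γ, for the patterns iijj, ijij and iiii. The
reflection forces γ = α + β. Dimension 2 is excluded because there the reflection is only a signed
permutation and gives no new relation. -/
theorem conjMoment_shape (A : Matrix ι ι ℂ) (hN : 3 ≤ Fintype.card ι) :
    ∃ α β : ℂ, ∀ i j k l, conjMoment A i j k l =
      α * ((if i = j then 1 else 0) * (if k = l then 1 else 0)) +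
        β * ((if i = k then 1 else 0) * (if j = l then 1 else 0)) := by
  obtain ⟨i₀, j₀, h₀⟩ := Fintype.exists_pair_of_one_lt_card (by omega : 1 < Fintype.card ι)
  have hα : ∀ i j, i ≠ j → conjMoment A i i j j = conjMoment A i₀ i₀ j₀ j₀ := by
    intro i j h
    obtain ⟨σ, h1, h2⟩ := exists_perm_map_pair h h₀
    rw [conjMoment_perm A σ, h1, h2]
  have hβ : ∀ i j, i ≠ j → conjMoment A i j i j = conjMoment A i₀ j₀ i₀ j₀ := by
    intro i j h
    obtain ⟨σ, h1, h2⟩ := exists_perm_map_pair h h₀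
    rw [conjMoment_perm A σ, h1, h2]
  have hγ : ∀ i, conjMoment A i i i i = conjMoment A i₀ i₀ i₀ i₀ := by
    intro i
    rw [conjMoment_perm A (Equiv.swap i i₀)]
    simp
  set α := conjMoment A i₀ i₀ j₀ j₀
  set β := conjMoment A i₀ j₀ i₀ j₀
  set γ := conjMoment A i₀ i₀ i₀ i₀
  have hT : ∀ i j k l, conjMoment A i j k l =
      α * ((if i = j then 1 else 0) * (if k = l then 1 else 0)) +
        β * ((if i = k then 1 else 0) * (if j = l then 1 else 0)) +
        (γ - α - β) * ((if i = j then 1 else 0) * (if k = l then 1 else 0) *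
          (if i = k then 1 else 0)) := by
    intro i j k l
    by_cases h1 : i = j ∧ k = l
    · obtain ⟨rfl, rfl⟩ := h1
      by_cases h2 : i = k
      · subst h2; simp [hγ]
      · simp [h2, hα]
    · by_cases h2 : i = k ∧ j = l
      · obtain ⟨rfl, rfl⟩ := h2
        have h3 : i ≠ j := fun h => h1 ⟨h, h⟩
        simp [h3, hβ]
      · rw [conjMoment_eq_zero A h1 h2]
        have e1 : ((if i = j then 1 else 0) * (if k = l then 1 else 0) : ℂ) = 0 := by
          rcases not_and_or.mp h1 with h | h <;> simp [h]
        have e2 : ((if i = k then 1 else 0) * (if j = l then 1 else 0) : ℂ) = 0 := by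
          rcases not_and_or.mp h2 with h | h <;> simp [h]
        rw [e1, e2]; simp
  have hγ' : γ - α - β = 0 := by
    have hN0 : (Fintype.card ι : ℂ) ≠ 0 := by
      have : Fintype.card ι ≠ 0 := by omega
      exact_mod_cast this
    have hrot := conjMoment_eq_rotated A (reflectionUnitary hN0) i₀ i₀ i₀ i₀
    have hsum2 : ∑ a, star ((reflectionUnitary hN0 : Matrix ι ι ℂ) a i₀) *
        (reflectionUnitary hN0 : Matrix ι ι ℂ) a i₀ = 1 := by
      have := Matrix.mem_unitaryGroup_iff'.mp (reflectionUnitary hN0).2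
      have := congrFun (congrFun this i₀) i₀
      simpa [Matrix.mul_apply] using this
    set u : ι → ℂ := fun a => (reflectionUnitary hN0 : Matrix ι ι ℂ) a i₀ with hu
    have hu1 : ∀ a, u a = (if a = i₀ then 1 else 0) - 2 / (Fintype.card ι : ℂ) := fun a => rfl
    have hus : ∀ a, star (u a) = u a := by
      intro a; rw [hu1]; split_ifs <;> simp
    have hsum2' : ∑ a, u a * u a = 1 := by
      rw [← hsum2]; exact Finset.sum_congr rfl fun a _ => by rw [hus]
    have hexp : conjMoment A i₀ i₀ i₀ i₀ = ∑ p : ι × ι, ∑ p' : ι × ι,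
        (u p.1 * u p.2 * (u p'.1 * u p'.2)) * conjMoment A p.1 p.2 p'.1 p'.2 := by
      rw [hrot]
      refine Finset.sum_congr rfl fun p _ => Finset.sum_congr rfl fun p' _ => ?_
      rw [← hus p.1, ← hus p'.2]
    -- The column u of the reflection is real of unit length, so only the γ - α - β term
    -- distinguishes it from a basis vector, through the sum of u ^ 4.
    have hval : γ = α + β + (γ - α - β) * ∑ a, u a ^ 4 := by
      have : γ = α * ((∑ a, u a * u a) * ∑ a, u a * u a) +
          β * ((∑ a, u a * u a) * ∑ a, u a * u a) + (γ - α - β) * ∑ a, u a ^ 4 := by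
        change conjMoment A i₀ i₀ i₀ i₀ = _
        rw [hexp]
        simp only [hT, mul_add, Finset.sum_add_distrib, Fintype.sum_prod_type]
        congr 1
        · congr 1
          · rw [Finset.sum_mul_sum, Finset.mul_sum]
            refine Finset.sum_congr rfl fun a _ => ?_
            rw [Finset.mul_sum]
            simp only [mul_ite, mul_one, mul_zero, Finset.sum_ite_eq, Finset.mem_univ, if_true,
              Finset.sum_ite_irrel, Finset.sum_const_zero]
            exact Finset.sum_congr rfl fun _ _ => by ring
          · rw [Finset.sum_mul_sum, Finset.mul_sum]
            refine Finset.sum_congr rfl fun a _ => ?_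
            rw [Finset.mul_sum]
            simp only [mul_ite, mul_one, mul_zero, Finset.sum_ite_eq, Finset.mem_univ, if_true]
            exact Finset.sum_congr rfl fun _ _ => by ring
        · simp [Finset.mul_sum]
          exact Finset.sum_congr rfl fun _ _ => by ring
      rw [hsum2'] at this
      linear_combination this
    -- All entries have modulus below 1, and the entry -2 / N at `j₀` is nonzero, so the sum of
    -- fourth powers is strictly below the sum of squares.
    have hsum4 : ∑ a, u a ^ 4 ≠ 1 := by
      intro h4
      have h5 : ∑ a, (u a * u a - u a ^ 4) = 0 := by
        rw [Finset.sum_sub_distrib, hsum2', h4, sub_self]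
      have hN' : (0 : ℝ) < Fintype.card ι := by
        have : 0 < Fintype.card ι := by omega
        exact_mod_cast this
      have hN3 : (3 : ℝ) ≤ Fintype.card ι := by exact_mod_cast hN
      set v : ι → ℝ := fun a => (if a = i₀ then 1 else 0) - 2 / (Fintype.card ι : ℝ) with hv
      have huv : ∀ a, u a = (v a : ℂ) := by
        intro a; rw [hu1, hv]; push_cast; split_ifs <;> simp
      have h6 : ∑ a, (v a * v a - v a ^ 4) = 0 := by
        have : ((∑ a, (v a * v a - v a ^ 4) : ℝ) : ℂ) = 0 := by
          push_cast
          rw [← h5]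
          exact Finset.sum_congr rfl fun a _ => by rw [huv]
        exact_mod_cast this
      have hs1 : 2 / (Fintype.card ι : ℝ) < 1 := by
        rw [div_lt_one hN']; linarith
      have hs0 : 0 < 2 / (Fintype.card ι : ℝ) := by positivity
      have h7 : ∀ a, 0 < v a * v a - v a ^ 4 ∨ v a = 0 := by
        intro a
        by_cases hva : v a = 0
        · exact Or.inr hva
        · left
          have hb : |v a| < 1 := by
            rw [abs_lt, hv]; dsimp only
            split_ifs <;> constructor <;> linarith
          have hb2 : v a ^ 2 < 1 := by rw [sq_lt_one_iff_abs_lt_one]; exact hb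
          have hp : 0 < v a ^ 2 := by positivity
          nlinarith
      have h8 := (Finset.sum_eq_zero_iff_of_nonneg (s := Finset.univ) (fun a _ => by
        rcases h7 a with h | h
        · exact h.le
        · simp [h])).mp h6 j₀ (Finset.mem_univ _)
      have h9 : v j₀ ≠ 0 := by
        simp only [hv, if_neg h₀.symm]; linarith
      rcases h7 j₀ with h | h
      · linarith
      · exact h9 h
    have : (γ - α - β) * (1 - ∑ a, u a ^ 4) = 0 := by linear_combination hval
    rcases mul_eq_zero.mp this with h | h
    · exact h
    · exact absurd (sub_eq_zero.mp h).symm hsum4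
  refine ⟨α, β, fun i j k l => ?_⟩
  rw [hT, hγ']; ring

/-- The two constants solve two linear equations: the trace of Vᴴ A V is zero, and its
Hilbert–Schmidt norm is that of A. -/
theorem conjMoment_apply (A : Matrix ι ι ℂ) (hN : 3 ≤ Fintype.card ι) (hA : A.trace = 0)
    (i j k l : ι) : conjMoment A i j k l =
      (Aᴴ * A).trace / ((Fintype.card ι : ℂ) * ((Fintype.card ι : ℂ) ^ 2 - 1)) *
        ((Fintype.card ι : ℂ) * ((if i = k then 1 else 0) * (if j = l then 1 else 0)) -
        ((if i = j then 1 else 0) * (if k = l then 1 else 0))) := by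
  obtain ⟨α, β, h⟩ := conjMoment_shape A hN
  set N : ℂ := (Fintype.card ι : ℂ) with hNdef
  have h1 : α * N + β = 0 := by
    have := sum_conjMoment_trace A hA i
    simp only [h, Finset.sum_add_distrib] at this
    simpa [mul_comm] using this
  have h2 : α * N + β * N ^ 2 = (Aᴴ * A).trace := by
    have := sum_conjMoment_norm A
    simp only [h, Finset.sum_add_distrib, Fintype.sum_prod_type] at this
    rw [← this]
    simp
    ring
  have hN3 : (3 : ℝ) ≤ Fintype.card ι := by exact_mod_cast hN
  have hN0 : N ≠ 0 := by
    rw [hNdef]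
    have : (Fintype.card ι : ℝ) ≠ 0 := by linarith
    exact_mod_cast this
  have hN1 : N ^ 2 - 1 ≠ 0 := by
    rw [hNdef]
    have : (Fintype.card ι : ℝ) ^ 2 - 1 ≠ 0 := by nlinarith
    exact_mod_cast this
  have hβ : β = -(α * N) := by linear_combination h1
  subst hβ
  have hα : α = -(Aᴴ * A).trace / (N * (N ^ 2 - 1)) := by
    rw [eq_div_iff (mul_ne_zero hN0 hN1)]
    linear_combination -h2
  rw [h, hα]
  field_simp
  ring

theorem linearMap_apply_eq_sum (L : Matrix ι ι ℂ →ₗ[ℂ] ℂ) (X : Matrix ι ι ℂ) :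
    L X = ∑ p : ι × ι, L (Matrix.single p.1 p.2 1) * X p.1 p.2 := by
  conv_lhs => rw [Matrix.matrix_eq_sum_single X]
  rw [map_sum, Fintype.sum_prod_type]
  refine Finset.sum_congr rfl fun i _ => ?_
  rw [map_sum]
  refine Finset.sum_congr rfl fun j _ => ?_
  rw [show Matrix.single i j (X i j) = X i j • Matrix.single i j (1 : ℂ) by
    rw [Matrix.smul_single]; simp, map_smul, smul_eq_mul, mul_comm]

theorem integral_norm_sq_eq (ν : Measure (Matrix.unitaryGroup ι ℂ))
    (f : Matrix.unitaryGroup ι ℂ → ℂ) :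
    ((∫ V, ‖f V‖ ^ 2 ∂ν : ℝ) : ℂ) = ∫ V, f V * star (f V) ∂ν := by
  rw [← integral_complex_ofReal]
  refine integral_congr_ae (Filter.Eventually.of_forall fun V => ?_)
  dsimp only
  rw [Complex.star_def, Complex.mul_conj, Complex.normSq_eq_norm_sq]

theorem haar_integral_norm_sq (A : Matrix ι ι ℂ) (hN : 3 ≤ Fintype.card ι) (hA : A.trace = 0)
    (L : Matrix ι ι ℂ →ₗ[ℂ] ℂ) :
    ((∫ V : Matrix.unitaryGroup ι ℂ, ‖L ((V : Matrix ι ι ℂ)ᴴ * A * V)‖ ^ 2 ∂(haarUnitary ι) : ℝ) :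
        ℂ) =
      (Aᴴ * A).trace / ((Fintype.card ι : ℂ) * ((Fintype.card ι : ℂ) ^ 2 - 1)) *
        ((Fintype.card ι : ℂ) *
          ∑ p : ι × ι, L (Matrix.single p.1 p.2 1) * star (L (Matrix.single p.1 p.2 1)) -
          L 1 * star (L 1)) := by
  rw [integral_norm_sq_eq]
  have h1 : ∀ V : Matrix.unitaryGroup ι ℂ,
      L ((V : Matrix ι ι ℂ)ᴴ * A * V) * star (L ((V : Matrix ι ι ℂ)ᴴ * A * V)) =
      ∑ p : ι × ι, ∑ p' : ι × ι,
        (L (Matrix.single p.1 p.2 1) * star (L (Matrix.single p'.1 p'.2 1))) *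
        (((V : Matrix ι ι ℂ)ᴴ * A * V) p.1 p.2 *
          star (((V : Matrix ι ι ℂ)ᴴ * A * V) p'.1 p'.2)) := by
    intro V
    rw [linearMap_apply_eq_sum L, star_sum, Finset.sum_mul_sum]
    refine Finset.sum_congr rfl fun _ _ => Finset.sum_congr rfl fun _ _ => ?_
    rw [star_mul']; ring
  rw [integral_congr_ae (Filter.Eventually.of_forall h1)]
  rw [integral_finsetSum _ fun p _ => integrable_finsetSum _ fun p' _ =>
    (integrable_conj_apply_mul A _ _ _ _).const_mul _]
  have h2 : ∀ p : ι × ι, ∫ V : Matrix.unitaryGroup ι ℂ, ∑ p' : ι × ι,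
        (L (Matrix.single p.1 p.2 1) * star (L (Matrix.single p'.1 p'.2 1))) *
        (((V : Matrix ι ι ℂ)ᴴ * A * V) p.1 p.2 *
          star (((V : Matrix ι ι ℂ)ᴴ * A * V) p'.1 p'.2)) ∂(haarUnitary ι) =
      ∑ p' : ι × ι, (L (Matrix.single p.1 p.2 1) * star (L (Matrix.single p'.1 p'.2 1))) *
        conjMoment A p.1 p.2 p'.1 p'.2 := by
    intro p
    rw [integral_finsetSum _ fun p' _ => (integrable_conj_apply_mul A _ _ _ _).const_mul _]
    refine Finset.sum_congr rfl fun p' _ => ?_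
    rw [integral_const_mul]; rfl
  rw [Finset.sum_congr rfl fun p _ => h2 p]
  have h3 : L 1 = ∑ i, L (Matrix.single i i 1) := by
    rw [linearMap_apply_eq_sum L, Fintype.sum_prod_type]
    simp [Matrix.one_apply]
  rw [h3]
  simp only [conjMoment_apply A hN hA]
  set c := (Aᴴ * A).trace / ((Fintype.card ι : ℂ) * ((Fintype.card ι : ℂ) ^ 2 - 1))
  have h4 : ∀ p p' : ι × ι,
      (L (Matrix.single p.1 p.2 1) * star (L (Matrix.single p'.1 p'.2 1))) *
      (c * ((Fintype.card ι : ℂ) *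
        ((if p.1 = p'.1 then 1 else 0) * (if p.2 = p'.2 then 1 else 0)) -
        ((if p.1 = p.2 then 1 else 0) * (if p'.1 = p'.2 then 1 else 0)))) =
      c * (Fintype.card ι : ℂ) * (if p = p' then
        L (Matrix.single p.1 p.2 1) * star (L (Matrix.single p'.1 p'.2 1)) else 0) -
      c * ((if p.1 = p.2 then L (Matrix.single p.1 p.2 1) else 0) *
        (if p'.1 = p'.2 then star (L (Matrix.single p'.1 p'.2 1)) else 0)) := by
    intro p p'
    have e : ((if p.1 = p'.1 then 1 else 0) * (if p.2 = p'.2 then 1 else 0) : ℂ) =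
        if p = p' then 1 else 0 := by
      by_cases h1 : p.1 = p'.1 <;> by_cases h2 : p.2 = p'.2 <;> simp [Prod.ext_iff, h1, h2]
    rw [e]
    split_ifs <;> ring
  simp only [h4, Finset.sum_sub_distrib, ← Finset.mul_sum, Finset.sum_ite_eq, Finset.mem_univ,
    if_true, ← Finset.sum_mul]
  have h5 : ∑ p : ι × ι, (if p.1 = p.2 then L (Matrix.single p.1 p.2 1) else 0) =
      ∑ i, L (Matrix.single i i 1) := by
    simp [Fintype.sum_prod_type]
  have h6 : ∑ p : ι × ι, (if p.1 = p.2 then star (L (Matrix.single p.1 p.2 1)) else 0) =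
      ∑ i, star (L (Matrix.single i i 1)) := by
    simp [Fintype.sum_prod_type]
  rw [h5, h6, star_sum]
  ring

/-- The integrand is a polynomial of degree two in the entries of V and two in their conjugates,
which is what the moments of a 2-design control. -/
theorem IsTwoDesign.integral_norm_sq_eq_haar {ν : Measure (Matrix.unitaryGroup ι ℂ)}
    (hν : IsTwoDesign ν) (A : Matrix ι ι ℂ) (L : Matrix ι ι ℂ →ₗ[ℂ] ℂ) :
    ∫ V : Matrix.unitaryGroup ι ℂ, ‖L ((V : Matrix ι ι ℂ)ᴴ * A * V)‖ ^ 2 ∂ν =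
      ∫ V : Matrix.unitaryGroup ι ℂ, ‖L ((V : Matrix ι ι ℂ)ᴴ * A * V)‖ ^ 2 ∂(haarUnitary ι) := by
  have := hν.isProbabilityMeasure
  have key : ∀ (ρ : Measure (Matrix.unitaryGroup ι ℂ)) [IsProbabilityMeasure ρ],
      ((∫ V : Matrix.unitaryGroup ι ℂ, ‖L ((V : Matrix ι ι ℂ)ᴴ * A * V)‖ ^ 2 ∂ρ : ℝ) : ℂ) =
      ∑ r : (ι × ι) × (ι × ι), ∑ r' : (ι × ι) × (ι × ι),
        ((L (Matrix.single r.1.1 r.1.2 1) * A r.2.1 r.2.2) *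
          star (L (Matrix.single r'.1.1 r'.1.2 1) * A r'.2.1 r'.2.2)) *
        ∫ V : Matrix.unitaryGroup ι ℂ, (V : Matrix ι ι ℂ) r.2.2 r.1.2 *
          (V : Matrix ι ι ℂ) r'.2.1 r'.1.1 * star ((V : Matrix ι ι ℂ) r.2.1 r.1.1) *
          star ((V : Matrix ι ι ℂ) r'.2.2 r'.1.2) ∂ρ := by
    intro ρ _
    rw [integral_norm_sq_eq]
    have h0 : ∀ V : Matrix.unitaryGroup ι ℂ, L ((V : Matrix ι ι ℂ)ᴴ * A * V) =
        ∑ r : (ι × ι) × (ι × ι), (L (Matrix.single r.1.1 r.1.2 1) * A r.2.1 r.2.2) *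
          (star ((V : Matrix ι ι ℂ) r.2.1 r.1.1) * (V : Matrix ι ι ℂ) r.2.2 r.1.2) := by
      intro V
      rw [linearMap_apply_eq_sum L, Fintype.sum_prod_type (f := fun r : (ι × ι) × (ι × ι) => _)]
      refine Finset.sum_congr rfl fun p _ => ?_
      rw [Fintype.sum_prod_type, Finset.sum_comm]
      simp only [Matrix.mul_apply, Finset.sum_mul, Finset.mul_sum, Matrix.conjTranspose_apply]
      exact Finset.sum_congr rfl fun _ _ => Finset.sum_congr rfl fun _ _ => by ring
    have h1 : ∀ V : Matrix.unitaryGroup ι ℂ,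
        L ((V : Matrix ι ι ℂ)ᴴ * A * V) * star (L ((V : Matrix ι ι ℂ)ᴴ * A * V)) =
        ∑ r : (ι × ι) × (ι × ι), ∑ r' : (ι × ι) × (ι × ι),
        ((L (Matrix.single r.1.1 r.1.2 1) * A r.2.1 r.2.2) *
          star (L (Matrix.single r'.1.1 r'.1.2 1) * A r'.2.1 r'.2.2)) *
        ((V : Matrix ι ι ℂ) r.2.2 r.1.2 *
          (V : Matrix ι ι ℂ) r'.2.1 r'.1.1 * star ((V : Matrix ι ι ℂ) r.2.1 r.1.1) *
          star ((V : Matrix ι ι ℂ) r'.2.2 r'.1.2)) := by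
      intro V
      rw [h0, star_sum, Finset.sum_mul_sum]
      refine Finset.sum_congr rfl fun _ _ => Finset.sum_congr rfl fun _ _ => ?_
      simp only [star_mul', star_star]; ring
    have hi : ∀ r r' : (ι × ι) × (ι × ι), Integrable (fun V : Matrix.unitaryGroup ι ℂ =>
        ((L (Matrix.single r.1.1 r.1.2 1) * A r.2.1 r.2.2) *
          star (L (Matrix.single r'.1.1 r'.1.2 1) * A r'.2.1 r'.2.2)) *
        ((V : Matrix ι ι ℂ) r.2.2 r.1.2 *
          (V : Matrix ι ι ℂ) r'.2.1 r'.1.1 * star ((V : Matrix ι ι ℂ) r.2.1 r.1.1) *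
          star ((V : Matrix ι ι ℂ) r'.2.2 r'.1.2))) ρ := fun r r' =>
      integrable_of_continuous_compact _ (continuous_const.mul
        ((((continuous_unitaryGroup_apply _ _).mul (continuous_unitaryGroup_apply _ _)).mul
          (continuous_unitaryGroup_apply _ _).star).mul (continuous_unitaryGroup_apply _ _).star))
    rw [integral_congr_ae (Filter.Eventually.of_forall h1),
      integral_finsetSum _ fun r _ => integrable_finsetSum _ fun r' _ => hi r r']
    refine Finset.sum_congr rfl fun r _ => ?_
    rw [integral_finsetSum _ fun r' _ => hi r r']
    exact Finset.sum_congr rfl fun r' _ => integral_const_mul _ _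
  have h : ((∫ V : Matrix.unitaryGroup ι ℂ, ‖L ((V : Matrix ι ι ℂ)ᴴ * A * V)‖ ^ 2 ∂ν : ℝ) : ℂ) =
      ((∫ V : Matrix.unitaryGroup ι ℂ,
        ‖L ((V : Matrix ι ι ℂ)ᴴ * A * V)‖ ^ 2 ∂(haarUnitary ι) : ℝ) : ℂ) := by
    rw [key, key]
    simp only [hν.moments]
  exact_mod_cast h

/-- Second moment of `Wᴴ A W` for `W = post * V * pre`, `V` drawn from a 2-design. -/
theorem IsTwoDesign.integral_norm_sq {ν : Measure (Matrix.unitaryGroup ι ℂ)}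
    (hν : IsTwoDesign ν) (A : Matrix ι ι ℂ) (hN : 3 ≤ Fintype.card ι) (hA : A.trace = 0)
    (hA2 : (Aᴴ * A).trace = Fintype.card ι)
    (L : Matrix ι ι ℂ →ₗ[ℂ] ℂ) (S T : Matrix.unitaryGroup ι ℂ) :
    ∫ V : Matrix.unitaryGroup ι ℂ,
        ‖L (((S : Matrix ι ι ℂ) * (V : Matrix ι ι ℂ) * (T : Matrix ι ι ℂ))ᴴ * A * ((S : Matrix ι ι ℂ) * (V : Matrix ι ι ℂ) * (T : Matrix ι ι ℂ)))‖ ^ 2 ∂ν =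
      ((Fintype.card ι : ℝ) * ∑ p : ι × ι, ‖L (Matrix.single p.1 p.2 1)‖ ^ 2 - ‖L 1‖ ^ 2) /
        ((Fintype.card ι : ℝ) ^ 2 - 1) := by
  let LT : Matrix ι ι ℂ →ₗ[ℂ] ℂ :=
    L ∘ₗ LinearMap.mulRight ℂ (T : Matrix ι ι ℂ) ∘ₗ LinearMap.mulLeft ℂ ((T : Matrix ι ι ℂ)ᴴ)
  -- A 2-design need not be invariant under translations, so S is first absorbed into A and T into
  -- L. Only after the passage to Haar measure are both removed by invariance.
  have e1 : ∀ V : Matrix.unitaryGroup ι ℂ,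
      L (((S : Matrix ι ι ℂ) * (V : Matrix ι ι ℂ) * (T : Matrix ι ι ℂ))ᴴ * A * ((S : Matrix ι ι ℂ) * (V : Matrix ι ι ℂ) * (T : Matrix ι ι ℂ))) =
      LT ((V : Matrix ι ι ℂ)ᴴ * ((S : Matrix ι ι ℂ)ᴴ * A * S) * V) := by
    intro V
    simp [LT, Matrix.conjTranspose_mul, Matrix.mul_assoc]
  simp only [e1]
  rw [hν.integral_norm_sq_eq_haar]
  simp only [← e1]
  have e2 : ∫ V : Matrix.unitaryGroup ι ℂ,
        ‖L (((S : Matrix ι ι ℂ) * (V : Matrix ι ι ℂ) * (T : Matrix ι ι ℂ))ᴴ * A * ((S : Matrix ι ι ℂ) * (V : Matrix ι ι ℂ) * (T : Matrix ι ι ℂ)))‖ ^ 2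
          ∂(haarUnitary ι) =
      ∫ V : Matrix.unitaryGroup ι ℂ, ‖L ((V : Matrix ι ι ℂ)ᴴ * A * V)‖ ^ 2 ∂(haarUnitary ι) := by
    rw [← integral_mul_right_eq_self
      (fun V : Matrix.unitaryGroup ι ℂ => ‖L ((V : Matrix ι ι ℂ)ᴴ * A * V)‖ ^ 2) T,
      ← integral_mul_left_eq_self (fun V : Matrix.unitaryGroup ι ℂ =>
        ‖L (((V * T : Matrix.unitaryGroup ι ℂ) : Matrix ι ι ℂ)ᴴ * A *
          ((V * T : Matrix.unitaryGroup ι ℂ) : Matrix ι ι ℂ))‖ ^ 2) S]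
    simp only [Submonoid.coe_mul]
  rw [e2]
  have hN3 : (3 : ℝ) ≤ Fintype.card ι := by exact_mod_cast hN
  have h := haar_integral_norm_sq A hN hA L
  have hn : ∀ z : ℂ, z * star z = ((‖z‖ ^ 2 : ℝ) : ℂ) := fun z => by
    rw [Complex.star_def, Complex.mul_conj, Complex.normSq_eq_norm_sq]
  simp only [hn, hA2] at h
  have hN0 : (Fintype.card ι : ℂ) ≠ 0 := by
    have : (Fintype.card ι : ℝ) ≠ 0 := by linarith
    exact_mod_cast this
  have h' : (((∫ V : Matrix.unitaryGroup ι ℂ,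
      ‖L ((V : Matrix ι ι ℂ)ᴴ * A * V)‖ ^ 2 ∂(haarUnitary ι) : ℝ)) : ℂ) =
      ((((Fintype.card ι : ℝ) * ∑ p : ι × ι, ‖L (Matrix.single p.1 p.2 1)‖ ^ 2 - ‖L 1‖ ^ 2) /
        ((Fintype.card ι : ℝ) ^ 2 - 1) : ℝ) : ℂ) := by
    rw [h]
    push_cast
    rw [div_mul_eq_div_div, div_self hN0, one_div, div_eq_inv_mul]
  exact_mod_cast h'

end SecondMoment

/-! ### Completeness of the operator basis and the action of a random gate on it -/

section Basis

variable {q : ℕ} [NeZero q] {M : Fin (q ^ 2) → Matrix (Fin q) (Fin q) ℂ}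

/-- Orthogonality says that the square matrix of all entries has orthonormal rows up to the factor
q; its columns are then orthonormal up to q as well. -/
theorem IsOperatorBasis.complete (hM : IsOperatorBasis M) (p p' : Fin q × Fin q) :
    ∑ a, M a p.1 p.2 * star (M a p'.1 p'.2) = if p = p' then (q : ℂ) else 0 := by
  have hq : (q : ℂ) ≠ 0 := by exact_mod_cast NeZero.ne q
  let B : Matrix (Fin (q ^ 2)) (Fin q × Fin q) ℂ := Matrix.of fun a p => M a p.1 p.2
  have h1 : B * ((q : ℂ)⁻¹ • Bᴴ) = 1 := by
    ext a b
    have h := hM.trace_eq b a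
    rw [Matrix.mul_smul, Matrix.smul_apply, Matrix.mul_apply]
    have : ∑ p, B a p * Bᴴ p b = ((M b)ᴴ * M a).trace := by
      rw [Matrix.trace, Fintype.sum_prod_type, Finset.sum_comm]
      simp [B, Matrix.mul_apply, mul_comm]
    rw [this, h, Matrix.one_apply, smul_eq_mul]
    by_cases hab : a = b
    · subst hab; simp [hq]
    · simp [hab, Ne.symm hab]
  have h2 : ((q : ℂ)⁻¹ • Bᴴ) * B = 1 :=
    (Matrix.mul_eq_one_comm_of_card_eq _ _ _ (by simp [sq])).mp h1
  have h3 := congrFun (congrFun h2 p') p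
  rw [Matrix.smul_mul, Matrix.smul_apply, Matrix.mul_apply, smul_eq_mul, inv_mul_eq_iff_eq_mul₀ hq,
    Matrix.one_apply] at h3
  rw [show (∑ a, M a p.1 p.2 * star (M a p'.1 p'.2)) = ∑ a, Bᴴ p' a * B a p from
    Finset.sum_congr rfl fun a _ => by simp [B, mul_comm], h3]
  by_cases h : p = p'
  · subst h; simp
  · simp [h, Ne.symm h]

/-- Parseval: it converts sums over matrix units into sums over the operator basis. -/
theorem sum_norm_sq_of_complete {ι κ : Type*} [Fintype ι] [DecidableEq ι] [Fintype κ]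
    {F : κ → Matrix ι ι ℂ} {c : ℝ}
    (hF : ∀ p p' : ι × ι, ∑ k, F k p.1 p.2 * star (F k p'.1 p'.2) = if p = p' then (c : ℂ) else 0)
    (L : Matrix ι ι ℂ →ₗ[ℂ] ℂ) :
    ∑ k, ‖L (F k)‖ ^ 2 = c * ∑ p : ι × ι, ‖L (Matrix.single p.1 p.2 1)‖ ^ 2 := by
  have hn : ∀ z : ℂ, ((‖z‖ ^ 2 : ℝ) : ℂ) = z * star z := fun z => by
    rw [Complex.star_def, Complex.mul_conj, Complex.normSq_eq_norm_sq]
  have : ((∑ k, ‖L (F k)‖ ^ 2 : ℝ) : ℂ) =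
      ((c * ∑ p : ι × ι, ‖L (Matrix.single p.1 p.2 1)‖ ^ 2 : ℝ) : ℂ) := by
    rw [Complex.ofReal_sum, Complex.ofReal_mul, Complex.ofReal_sum]
    simp only [hn]
    rw [Finset.sum_congr rfl fun k _ => by
      rw [linearMap_apply_eq_sum L (F k), star_sum, Finset.sum_mul_sum]]
    rw [Finset.sum_comm, Finset.mul_sum]
    refine Finset.sum_congr rfl fun p _ => ?_
    rw [Finset.sum_comm]
    calc _ = ∑ p' : ι × ι, (L (Matrix.single p.1 p.2 1) * star (L (Matrix.single p'.1 p'.2 1))) *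
          ∑ k, F k p.1 p.2 * star (F k p'.1 p'.2) := by
          refine Finset.sum_congr rfl fun p' _ => ?_
          rw [Finset.mul_sum]
          refine Finset.sum_congr rfl fun k _ => ?_
          rw [star_mul']; ring
      _ = _ := by
          simp only [hF, mul_ite, mul_zero, Finset.sum_ite_eq, Finset.mem_univ, if_true]
          ring
  exact_mod_cast this

theorem IsOperatorBasis.complete_pair (hM : IsOperatorBasis M)
    (p p' : (Fin q × Fin q) × (Fin q × Fin q)) :
    ∑ k : Fin (q ^ 2) × Fin (q ^ 2), (M k.1 ⊗ₖ M k.2) p.1 p.2 *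
      star ((M k.1 ⊗ₖ M k.2) p'.1 p'.2) = if p = p' then (((q : ℝ) ^ 2 : ℝ) : ℂ) else 0 := by
  have h1 := hM.complete (p.1.1, p.2.1) (p'.1.1, p'.2.1)
  have h2 := hM.complete (p.1.2, p.2.2) (p'.1.2, p'.2.2)
  rw [Fintype.sum_prod_type]
  calc _ = (∑ a, M a p.1.1 p.2.1 * star (M a p'.1.1 p'.2.1)) *
      ∑ b, M b p.1.2 p.2.2 * star (M b p'.1.2 p'.2.2) := by
        rw [Finset.sum_mul_sum]
        refine Finset.sum_congr rfl fun a _ => Finset.sum_congr rfl fun b _ => ?_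
        simp only [Matrix.kroneckerMap_apply, star_mul']; ring
    _ = _ := by
        rw [h1, h2]
        obtain ⟨⟨a, b⟩, ⟨c, d⟩⟩ := p
        obtain ⟨⟨a', b'⟩, ⟨c', d'⟩⟩ := p'
        simp only [Prod.mk.injEq]
        push_cast
        by_cases ha : a = a' <;> by_cases hb : b = b' <;> by_cases hc : c = c' <;>
          by_cases hd : d = d' <;> simp [ha, hb, hc, hd, sq]

theorem IsOperatorBasis.trace_eq_zero (hM : IsOperatorBasis M) {a : Fin (q ^ 2)} (ha : a ≠ 0) :
    (M a).trace = 0 := by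
  have := hM.trace_eq 0 a
  simpa [hM.zero_eq_one, Ne.symm ha] using this

/-- A block with a 2-design gate maps a nontrivial pair of basis elements to the uniform mixture of
all nontrivial pairs. -/
theorem IsOperatorBasis.integral_norm_sq (hM : IsOperatorBasis M) (hq : 2 ≤ q)
    {ν : Measure (Matrix.unitaryGroup (Fin q × Fin q) ℂ)} (hν : IsTwoDesign ν)
    {r : Fin (q ^ 2) × Fin (q ^ 2)} (hr : r ≠ 0) (L : PairOp q →ₗ[ℂ] ℂ)
    (S T : Matrix.unitaryGroup (Fin q × Fin q) ℂ) :
    ∫ V : Matrix.unitaryGroup (Fin q × Fin q) ℂ,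
        ‖L (((S : PairOp q) * (V : PairOp q) * (T : PairOp q))ᴴ * (M r.1 ⊗ₖ M r.2) *
          ((S : PairOp q) * (V : PairOp q) * (T : PairOp q)))‖ ^ 2 ∂ν =
      (∑ k ∈ Finset.univ.erase (0 : Fin (q ^ 2) × Fin (q ^ 2)), ‖L (M k.1 ⊗ₖ M k.2)‖ ^ 2) /
        ((q : ℝ) ^ 4 - 1) := by
  have hcard : Fintype.card (Fin q × Fin q) = q * q := by simp
  rw [hν.integral_norm_sq _ (by rw [hcard]; nlinarith) ?_ ?_ L S T]
  -- By Parseval the first term of the moment formula is the sum over all pairs; subtracting |L(1)|²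
  -- removes exactly the identity pair.
  · have h := sum_norm_sq_of_complete hM.complete_pair L
    have h1 : M (0 : Fin (q ^ 2) × Fin (q ^ 2)).1 ⊗ₖ M (0 : Fin (q ^ 2) × Fin (q ^ 2)).2 = 1 := by
      simp [hM.zero_eq_one]
    rw [← Finset.add_sum_erase _ _ (Finset.mem_univ (0 : Fin (q ^ 2) × Fin (q ^ 2))), h1] at h
    rw [hcard]
    push_cast
    congr 1
    · linear_combination -h
    · ring
  · rw [Matrix.trace_kronecker]
    by_cases h1 : r.1 = 0
    · have h2 : r.2 ≠ 0 := fun h2 => hr (Prod.ext h1 h2)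
      rw [hM.trace_eq_zero h2, mul_zero]
    · rw [hM.trace_eq_zero h1, zero_mul]
  · rw [Matrix.conjTranspose_kronecker, ← Matrix.mul_kronecker_mul, Matrix.trace_kronecker,
      hM.trace_eq, hM.trace_eq, hcard]
    simp

end Basis

/-! ### Two-site operators inside the n-qudit space -/

section Sites

variable {q n : ℕ}

/-- Splitting a configuration into its values at `i`, `j` and on the other sites. -/
def splitPair (q : ℕ) {i j : Fin n} (h : i ≠ j) :
    (Fin n → Fin q) ≃ (Fin q × Fin q) × ({l : Fin n // l ≠ i ∧ l ≠ j} → Fin q) where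
  toFun s := ((s i, s j), fun l => s l)
  invFun p := fun l => if hi : l = i then p.1.1 else if hj : l = j then p.1.2 else p.2 ⟨l, hi, hj⟩
  left_inv s := by
    ext l
    by_cases hi : l = i
    · simp [hi]
    · by_cases hj : l = j
      · subst hj; simp [hi]
      · simp [hi, hj]
  right_inv p := by
    ext l
    · simp
    · simp [h.symm]
    · have h1 := l.2.1
      have h2 := l.2.2
      simp [h1, h2]

theorem onPair_eq_submatrix {i j : Fin n} (h : i ≠ j) (G : PairOp q) :
    onPair i j G = (G ⊗ₖ (1 : Matrix ({l : Fin n // l ≠ i ∧ l ≠ j} → Fin q) _ ℂ)).submatrix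
      (splitPair q h) (splitPair q h) := by
  ext s t
  have : (∀ l, l ≠ i → l ≠ j → s l = t l) ↔
      ((fun l : {l : Fin n // l ≠ i ∧ l ≠ j} => s l) = fun l : {l : Fin n // l ≠ i ∧ l ≠ j} => t l) := by
    simp [funext_iff]
  simp only [onPair, splitPair, Equiv.coe_fn_mk, Matrix.of_apply, this, Matrix.submatrix_apply,
    Matrix.kroneckerMap_apply, Matrix.one_apply, mul_ite, mul_one, mul_zero]

/-- The tensor product of the `M (x l)` over the sites other than `i`, `j`. -/
def restOp (M : Fin (q ^ 2) → Matrix (Fin q) (Fin q) ℂ) (x : Fin n → Fin (q ^ 2)) (i j : Fin n) :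
    Matrix ({l : Fin n // l ≠ i ∧ l ≠ j} → Fin q) ({l : Fin n // l ≠ i ∧ l ≠ j} → Fin q) ℂ :=
  Matrix.of fun s t => ∏ l : {l : Fin n // l ≠ i ∧ l ≠ j}, M (x l) (s l) (t l)

theorem prod_eq_mul_mul_prod {R : Type*} [CommMonoid R] {i j : Fin n} (h : i ≠ j) (f : Fin n → R) :
    ∏ l, f l = f i * f j * ∏ l : {l : Fin n // l ≠ i ∧ l ≠ j}, f l := by
  rw [← Finset.mul_prod_erase _ f (Finset.mem_univ i),
    ← Finset.mul_prod_erase _ f (Finset.mem_erase.mpr ⟨h.symm, Finset.mem_univ j⟩), ← mul_assoc]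
  congr 1
  exact Finset.prod_subtype _ (by simp [and_comm]) f

theorem tensorOp_eq_submatrix {i j : Fin n} (h : i ≠ j)
    (M : Fin (q ^ 2) → Matrix (Fin q) (Fin q) ℂ) (x : Fin n → Fin (q ^ 2)) :
    tensorOp M x = ((M (x i) ⊗ₖ M (x j)) ⊗ₖ restOp M x i j).submatrix
      (splitPair q h) (splitPair q h) := by
  ext s t
  simp [tensorOp, restOp, splitPair, prod_eq_mul_mul_prod h]

/-- Replacing the entries of `x` at `i` and `j`. -/
def setPair {β : Type*} (x : Fin n → β) (i j : Fin n) (r : β × β) : Fin n → β :=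
  Function.update (Function.update x i r.1) j r.2

theorem setPair_fst {β : Type*} (x : Fin n → β) {i j : Fin n} (h : i ≠ j) (r : β × β) :
    setPair x i j r i = r.1 := by simp [setPair, h]

theorem setPair_snd {β : Type*} (x : Fin n → β) {i j : Fin n} (r : β × β) :
    setPair x i j r j = r.2 := by simp [setPair]

theorem setPair_of_ne {β : Type*} (x : Fin n → β) {i j l : Fin n} (r : β × β) (h1 : l ≠ i)
    (h2 : l ≠ j) : setPair x i j r l = x l := by simp [setPair, h1, h2]

theorem tensorOp_setPair {i j : Fin n} (h : i ≠ j)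
    (M : Fin (q ^ 2) → Matrix (Fin q) (Fin q) ℂ) (x : Fin n → Fin (q ^ 2))
    (r : Fin (q ^ 2) × Fin (q ^ 2)) :
    tensorOp M (setPair x i j r) = ((M r.1 ⊗ₖ M r.2) ⊗ₖ restOp M x i j).submatrix
      (splitPair q h) (splitPair q h) := by
  rw [tensorOp_eq_submatrix h, setPair_fst x h, setPair_snd]
  congr 2
  ext s t
  simp only [restOp, Matrix.of_apply]
  exact Finset.prod_congr rfl fun l _ => by rw [setPair_of_ne x r l.2.1 l.2.2]

/-- The expectation value of `X` on the pair `i, j` times `M_x` on the other sites, as a linear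
functional of `X`. -/
def pairFunctional {i j : Fin n} (h : i ≠ j) (M : Fin (q ^ 2) → Matrix (Fin q) (Fin q) ℂ)
    (x : Fin n → Fin (q ^ 2)) (ψ : (Fin n → Fin q) → ℂ) : PairOp q →ₗ[ℂ] ℂ where
  toFun X := star ψ ⬝ᵥ
    (((X ⊗ₖ restOp M x i j).submatrix (splitPair q h) (splitPair q h)) *ᵥ ψ)
  map_add' X Y := by
    rw [Matrix.add_kronecker, Matrix.submatrix_add, Pi.add_apply, Pi.add_apply, Matrix.add_mulVec,
      dotProduct_add]
  map_smul' c X := by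
    rw [Matrix.smul_kronecker, Matrix.submatrix_smul, Pi.smul_apply, Pi.smul_apply,
      Matrix.smul_mulVec, dotProduct_smul]
    rfl

/-- Heisenberg picture: conjugation by a two-site block changes only the two tensor factors it
touches, so the expectation is a fixed functional of the conjugated pair. -/
theorem expect_onPair {i j : Fin n} (h : i ≠ j) (M : Fin (q ^ 2) → Matrix (Fin q) (Fin q) ℂ)
    (x : Fin n → Fin (q ^ 2)) (ψ : (Fin n → Fin q) → ℂ) (W : PairOp q) :
    star (onPair i j W *ᵥ ψ) ⬝ᵥ (tensorOp M x *ᵥ (onPair i j W *ᵥ ψ)) =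
      pairFunctional h M x ψ (Wᴴ * (M (x i) ⊗ₖ M (x j)) * W) := by
  have e : (onPair i j W)ᴴ * tensorOp M x * onPair i j W =
      ((Wᴴ * (M (x i) ⊗ₖ M (x j)) * W) ⊗ₖ restOp M x i j).submatrix
        (splitPair q h) (splitPair q h) := by
    rw [onPair_eq_submatrix h, tensorOp_eq_submatrix h, Matrix.conjTranspose_submatrix,
      Matrix.submatrix_mul_equiv, Matrix.submatrix_mul_equiv, Matrix.conjTranspose_kronecker,
      ← Matrix.mul_kronecker_mul, ← Matrix.mul_kronecker_mul]
    simp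
  simp only [pairFunctional, LinearMap.coe_mk, AddHom.coe_mk]
  rw [← e, Matrix.star_mulVec, ← Matrix.dotProduct_mulVec, Matrix.mulVec_mulVec,
    Matrix.mulVec_mulVec, Matrix.mul_assoc]

theorem pairFunctional_kronecker {i j : Fin n} (h : i ≠ j)
    (M : Fin (q ^ 2) → Matrix (Fin q) (Fin q) ℂ)
    (x : Fin n → Fin (q ^ 2)) (ψ : (Fin n → Fin q) → ℂ) (r : Fin (q ^ 2) × Fin (q ^ 2)) :
    pairFunctional h M x ψ (M r.1 ⊗ₖ M r.2) =
      star ψ ⬝ᵥ (tensorOp M (setPair x i j r) *ᵥ ψ) := by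
  rw [tensorOp_setPair h]; rfl

theorem onPair_mem_unitaryGroup {i j : Fin n} (h : i ≠ j) {G : PairOp q}
    (hG : G ∈ Matrix.unitaryGroup (Fin q × Fin q) ℂ) :
    onPair i j G ∈ Matrix.unitaryGroup (Fin n → Fin q) ℂ := by
  rw [Matrix.mem_unitaryGroup_iff, Matrix.star_eq_conjTranspose] at *
  rw [onPair_eq_submatrix h, Matrix.conjTranspose_submatrix, Matrix.submatrix_mul_equiv,
    Matrix.conjTranspose_kronecker, ← Matrix.mul_kronecker_mul, hG]
  simp

theorem continuous_onPair (i j : Fin n) : Continuous (onPair i j : PairOp q → Op q n) := by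
  refine continuous_matrix fun s t => ?_
  by_cases h : ∀ l, l ≠ i → l ≠ j → s l = t l
  · simp only [onPair, Matrix.of_apply, if_pos h]
    exact continuous_apply_apply _ _
  · simp only [onPair, Matrix.of_apply, if_neg h]
    exact continuous_const

end Sites

/-! ### Averaging over one independent gate at a time -/

section Resample

variable {Γ : Type*} [Fintype Γ] [DecidableEq Γ] {X : Type*} [TopologicalSpace X] [CompactSpace X]
  [SecondCountableTopology X] [MeasurableSpace X] [BorelSpace X]

omit [CompactSpace X] in
-- Resampling one coordinate independently does not change the product law. This makes it possible
-- to integrate out one gate with all the others fixed.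
theorem measurePreserving_update (μ : Γ → Measure X) [∀ g, IsProbabilityMeasure (μ g)] (g : Γ) :
    MeasurePreserving (fun p : (Γ → X) × X => Function.update p.1 g p.2)
      ((Measure.pi μ).prod (μ g)) (Measure.pi μ) := by
  have hm : Measurable fun p : (Γ → X) × X => Function.update p.1 g p.2 :=
    (continuous_fst.update g continuous_snd).measurable
  refine ⟨hm, (Measure.pi_eq fun s hs => ?_).symm⟩
  rw [Measure.map_apply hm (MeasurableSet.univ_pi hs)]
  have : (fun p : (Γ → X) × X => Function.update p.1 g p.2) ⁻¹' (Set.univ.pi s) =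
      (Set.univ.pi (Function.update s g Set.univ)) ×ˢ (s g) := by
    ext ⟨V, v⟩
    simp only [Set.mem_preimage, Set.mem_pi, Set.mem_univ, true_implies, Set.mem_prod]
    constructor
    · intro h
      refine ⟨fun i => ?_, by simpa using h g⟩
      by_cases hi : i = g
      · subst hi; simp
      · simpa [hi] using h i
    · rintro ⟨h1, h2⟩ i
      by_cases hi : i = g
      · subst hi; simpa using h2
      · simpa [hi] using h1 i
  rw [this, Measure.prod_prod, Measure.pi_pi, mul_comm,
    ← Finset.mul_prod_erase _ _ (Finset.mem_univ g),
    ← Finset.mul_prod_erase Finset.univ (fun i => μ i (s i)) (Finset.mem_univ g)]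
  simp only [Function.update_self, measure_univ, one_mul]
  congr 1
  exact Finset.prod_congr rfl fun i hi => by rw [Function.update_of_ne (Finset.ne_of_mem_erase hi)]

theorem integral_pi_update (μ : Γ → Measure X) [∀ g, IsProbabilityMeasure (μ g)] (g : Γ)
    {f : (Γ → X) → ℝ} (hf : Continuous f) :
    ∫ V, f V ∂(Measure.pi μ) = ∫ V, ∫ v, f (Function.update V g v) ∂(μ g) ∂(Measure.pi μ) := by
  have hmp := measurePreserving_update μ g
  have hc : Continuous fun p : (Γ → X) × X => f (Function.update p.1 g p.2) :=
    hf.comp (continuous_fst.update g continuous_snd)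
  rw [← hmp.map_eq, integral_map hmp.measurable.aemeasurable
    hf.measurable.aestronglyMeasurable, hmp.map_eq,
    integral_prod _ (integrable_of_continuous_compact _ hc)]

end Resample

/-- A family of two-site blocks `post * V * pre` with fixed unitaries `post` and `pre`. -/
structure BlockFamily (q n : ℕ) (Γ : Type*) where
  fst : Γ → Fin n
  snd : Γ → Fin n
  fst_ne_snd : ∀ g, fst g ≠ snd g
  post : Γ → Matrix.unitaryGroup (Fin q × Fin q) ℂ
  pre : Γ → Matrix.unitaryGroup (Fin q × Fin q) ℂ

/-! ### The Markov recursion for second moments -/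

namespace BlockFamily

variable {q n : ℕ} {Γ : Type*} [Fintype Γ] [DecidableEq Γ]

/-- The two-site operator of the block `g`. -/
def blockOp (B : BlockFamily q n Γ) (g : Γ) (v : Matrix.unitaryGroup (Fin q × Fin q) ℂ) :
    PairOp q :=
  (B.post g : PairOp q) * (v : PairOp q) * (B.pre g : PairOp q)

/-- The product of the blocks in the list `gs`; the last block of the list is applied first. -/
def circ (B : BlockFamily q n Γ) (gs : List Γ)
    (V : Γ → Matrix.unitaryGroup (Fin q × Fin q) ℂ) : Op q n :=
  (gs.map fun g => onPair (B.fst g) (B.snd g) (B.blockOp g (V g))).prod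

omit [Fintype Γ] [DecidableEq Γ] in
theorem continuous_circ (B : BlockFamily q n Γ) (gs : List Γ) : Continuous (B.circ gs) := by
  unfold circ
  refine continuous_list_prod _ fun g _ => ?_
  refine (continuous_onPair _ _).comp ?_
  unfold blockOp
  fun_prop

omit [Fintype Γ] in
theorem circ_update (B : BlockFamily q n Γ) {gs : List Γ} {g : Γ} (hg : g ∉ gs)
    (V : Γ → Matrix.unitaryGroup (Fin q × Fin q) ℂ) (v : Matrix.unitaryGroup (Fin q × Fin q) ℂ) :
    B.circ gs (Function.update V g v) = B.circ gs V := by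
  unfold circ
  congr 1
  refine List.map_congr_left fun g' hg' => ?_
  have : g' ≠ g := fun h => hg (h ▸ hg')
  rw [Function.update_of_ne this]

variable [NeZero q]

/-- The state prepared by the blocks in the list `gs`. -/
def state (B : BlockFamily q n Γ) (gs : List Γ)
    (V : Γ → Matrix.unitaryGroup (Fin q × Fin q) ℂ) : (Fin n → Fin q) → ℂ :=
  B.circ gs V *ᵥ zeroKet q n

/-- The second moment of the expectation value of `M_x` in the state prepared by `gs`. -/
def moment (B : BlockFamily q n Γ) (μ : Γ → Measure (Matrix.unitaryGroup (Fin q × Fin q) ℂ))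
    (M : Fin (q ^ 2) → Matrix (Fin q) (Fin q) ℂ) (gs : List Γ) (x : Fin n → Fin (q ^ 2)) : ℝ :=
  ∫ V, ‖star (B.state gs V) ⬝ᵥ (tensorOp M x *ᵥ B.state gs V)‖ ^ 2 ∂(Measure.pi μ)

omit [Fintype Γ] [DecidableEq Γ] in
theorem continuous_expect (B : BlockFamily q n Γ) (gs : List Γ) (O : Op q n) :
    Continuous fun V => ‖star (B.state gs V) ⬝ᵥ (O *ᵥ B.state gs V)‖ ^ 2 := by
  have h : Continuous (B.state gs) := (B.continuous_circ gs).matrix_mulVec continuous_const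
  exact ((h.star.dotProduct (continuous_const.matrix_mulVec h)).norm).pow 2

variable (B : BlockFamily q n Γ) {μ : Γ → Measure (Matrix.unitaryGroup (Fin q × Fin q) ℂ)}
  {M : Fin (q ^ 2) → Matrix (Fin q) (Fin q) ℂ}

omit [Fintype Γ] in
theorem expect_update {gs : List Γ} {g : Γ} (hg : g ∉ gs)
    (V : Γ → Matrix.unitaryGroup (Fin q × Fin q) ℂ) (v : Matrix.unitaryGroup (Fin q × Fin q) ℂ)
    (x : Fin n → Fin (q ^ 2)) :
    star (B.state (g :: gs) (Function.update V g v)) ⬝ᵥ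
        (tensorOp M x *ᵥ B.state (g :: gs) (Function.update V g v)) =
      pairFunctional (B.fst_ne_snd g) M x (B.state gs V)
        ((B.blockOp g v)ᴴ * (M (x (B.fst g)) ⊗ₖ M (x (B.snd g))) * B.blockOp g v) := by
  have : B.state (g :: gs) (Function.update V g v) =
      onPair (B.fst g) (B.snd g) (B.blockOp g v) *ᵥ B.state gs V := by
    unfold state
    rw [Matrix.mulVec_mulVec, ← B.circ_update hg V v]
    simp [circ]
  rw [this, expect_onPair (B.fst_ne_snd g)]

theorem moment_cons_of_trivial (hM : IsOperatorBasis M) (hμ : ∀ g, IsTwoDesign (μ g)) {gs : List Γ}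
    {g : Γ} (hg : g ∉ gs) {x : Fin n → Fin (q ^ 2)} (h1 : x (B.fst g) = 0) (h2 : x (B.snd g) = 0) :
    B.moment μ M (g :: gs) x = B.moment μ M gs x := by
  have := fun g => (hμ g).isProbabilityMeasure
  unfold moment
  rw [integral_pi_update μ g (B.continuous_expect _ _)]
  refine integral_congr_ae (Filter.Eventually.of_forall fun V => ?_)
  simp only [B.expect_update hg]
  have hu : ∀ v, B.blockOp g v ∈ Matrix.unitaryGroup (Fin q × Fin q) ℂ := fun v =>
    mul_mem (mul_mem (B.post g).2 v.2) (B.pre g).2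
  have hx : setPair x (B.fst g) (B.snd g) (0, 0) = x := by
    ext l
    simp only [setPair, ← h2]
    rw [Function.update_apply, Function.update_apply]
    split_ifs <;> simp [*]
  have : ∀ v, (B.blockOp g v)ᴴ * (M (x (B.fst g)) ⊗ₖ M (x (B.snd g))) * B.blockOp g v =
      M (0 : Fin (q ^ 2) × Fin (q ^ 2)).1 ⊗ₖ M (0 : Fin (q ^ 2) × Fin (q ^ 2)).2 := by
    intro v
    have := Matrix.mem_unitaryGroup_iff'.mp (hu v)
    rw [Matrix.star_eq_conjTranspose] at this
    simp [h1, h2, hM.zero_eq_one, this]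
  simp only [this]
  rw [pairFunctional_kronecker]
  have h0 : (0 : Fin (q ^ 2) × Fin (q ^ 2)) = (0, 0) := rfl
  simp [h0, hx]

/-- The transition step of the chain. Conditionally on the earlier gates, the expectation is a
linear functional of the conjugated pair, so the uniform-mixture formula applies; it does not see
which nonidentity pair was there. -/
theorem moment_cons_of_nontrivial (hM : IsOperatorBasis M) (hq : 2 ≤ q)
    (hμ : ∀ g, IsTwoDesign (μ g)) {gs : List Γ}
    {g : Γ} (hg : g ∉ gs) {x : Fin n → Fin (q ^ 2)}
    (h : ¬ (x (B.fst g) = 0 ∧ x (B.snd g) = 0)) :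
    B.moment μ M (g :: gs) x =
      (∑ r ∈ Finset.univ.erase (0 : Fin (q ^ 2) × Fin (q ^ 2)),
        B.moment μ M gs (setPair x (B.fst g) (B.snd g) r)) / ((q : ℝ) ^ 4 - 1) := by
  have := fun g => (hμ g).isProbabilityMeasure
  unfold moment
  rw [integral_pi_update μ g (B.continuous_expect _ _), ← integral_finsetSum, ← integral_div]
  · refine integral_congr_ae (Filter.Eventually.of_forall fun V => ?_)
    simp only [B.expect_update hg]
    have hr : (x (B.fst g), x (B.snd g)) ≠ 0 := fun e => h (Prod.ext_iff.mp e)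
    simp only [← pairFunctional_kronecker (B.fst_ne_snd g)]
    exact hM.integral_norm_sq hq (hμ g) hr _ (B.post g) (B.pre g)
  · intro r _
    exact integrable_of_continuous_compact _ (B.continuous_expect _ _)

omit [DecidableEq Γ] in
theorem moment_nil (hμ : ∀ g, IsTwoDesign (μ g)) (x : Fin n → Fin (q ^ 2)) :
    B.moment μ M [] x = ∏ i, ‖M (x i) 0 0‖ ^ 2 := by
  have := fun g => (hμ g).isProbabilityMeasure
  unfold moment
  have : ∀ V, B.state [] V = zeroKet q n := by
    intro V; simp [state, circ]
  simp [this, zeroKet, tensorOp, Finset.prod_pow, Pi.star_single]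

omit [DecidableEq Γ] in
theorem moment_nonneg (gs : List Γ) (x : Fin n → Fin (q ^ 2)) : 0 ≤ B.moment μ M gs x :=
  integral_nonneg fun _ => by positivity

end BlockFamily

/-! ### Exact value for one layer, and lower bounds through further layers -/

namespace BlockFamily

variable {q n : ℕ} {Γ : Type*} [Fintype Γ] [DecidableEq Γ] [NeZero q]
  (B : BlockFamily q n Γ) {μ : Γ → Measure (Matrix.unitaryGroup (Fin q × Fin q) ℂ)}
  {M : Fin (q ^ 2) → Matrix (Fin q) (Fin q) ℂ}

/-- The blocks `g` and `g'` act on disjoint pairs of sites. -/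
def Disjoint (g g' : Γ) : Prop :=
  (B.fst g ≠ B.fst g' ∧ B.fst g ≠ B.snd g') ∧ (B.snd g ≠ B.fst g' ∧ B.snd g ≠ B.snd g')

/-- The second moment contributed by a block acting directly on a computational basis state. -/
def weight (x : Fin n → Fin (q ^ 2)) (g : Γ) : ℝ :=
  if x (B.fst g) = 0 ∧ x (B.snd g) = 0 then 1 else 1 / ((q : ℝ) ^ 2 + 1)

theorem _root_.VariationalCircuit.IsOperatorBasis.sum_norm_sq_apply_zero
    (hM : IsOperatorBasis M) : ∑ a, ‖M a 0 0‖ ^ 2 = (q : ℝ) := by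
  have h := hM.complete (0, 0) (0, 0)
  simp only [if_true] at h
  have h2 : ((∑ a, ‖M a 0 0‖ ^ 2 : ℝ) : ℂ) = ((q : ℝ) : ℂ) := by
    push_cast
    rw [← h]
    refine Finset.sum_congr rfl fun a _ => ?_
    rw [Complex.star_def, Complex.mul_conj, Complex.normSq_eq_norm_sq]
    push_cast; rfl
  exact_mod_cast h2

/-- Each nontrivial block averages |⟨0|M_a|0⟩|² |⟨0|M_b|0⟩|² over nonidentity pairs. By completeness
the full sum is q ^ 2, and the identity pair accounts for 1 of it. The leftover product over
untouched sites may vanish, which is why the later bounds start from a layer covering all sites. -/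
theorem moment_of_pairwise_disjoint (hM : IsOperatorBasis M) (hq : 2 ≤ q)
    (hμ : ∀ g, IsTwoDesign (μ g)) {gs : List Γ} (hnd : gs.Nodup) (hd : gs.Pairwise B.Disjoint)
    (x : Fin n → Fin (q ^ 2)) :
    B.moment μ M gs x = (gs.map (B.weight x)).prod *
      ∏ i ∈ Finset.univ.filter (fun i => ∀ g ∈ gs, i ≠ B.fst g ∧ i ≠ B.snd g),
        ‖M (x i) 0 0‖ ^ 2 := by
  classical
  induction gs generalizing x with
  | nil => simp [B.moment_nil hμ]
  | cons g gs ih =>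
    rw [List.nodup_cons] at hnd
    rw [List.pairwise_cons] at hd
    have hw0 : ‖M 0 0 0‖ ^ 2 = 1 := by simp [hM.zero_eq_one]
    have hsplit : Finset.univ.filter (fun i => ∀ g ∈ gs, i ≠ B.fst g ∧ i ≠ B.snd g) =
        insert (B.fst g) (insert (B.snd g)
          (Finset.univ.filter (fun i => ∀ g' ∈ g :: gs, i ≠ B.fst g' ∧ i ≠ B.snd g'))) := by
      ext i
      simp only [Finset.mem_filter, Finset.mem_univ, true_and, Finset.mem_insert,
        List.forall_mem_cons]
      constructor
      · intro h
        by_cases h1 : i = B.fst g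
        · exact Or.inl h1
        · by_cases h2 : i = B.snd g
          · exact Or.inr (Or.inl h2)
          · exact Or.inr (Or.inr ⟨⟨h1, h2⟩, h⟩)
      · rintro (rfl | rfl | h)
        · exact fun g' hg' => (hd.1 g' hg').1
        · exact fun g' hg' => (hd.1 g' hg').2
        · exact h.2
    have hprod : ∀ y : Fin n → Fin (q ^ 2),
        ∏ i ∈ Finset.univ.filter (fun i => ∀ g ∈ gs, i ≠ B.fst g ∧ i ≠ B.snd g),
          ‖M (y i) 0 0‖ ^ 2 = ‖M (y (B.fst g)) 0 0‖ ^ 2 * (‖M (y (B.snd g)) 0 0‖ ^ 2 *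
        ∏ i ∈ Finset.univ.filter (fun i => ∀ g' ∈ g :: gs, i ≠ B.fst g' ∧ i ≠ B.snd g'),
          ‖M (y i) 0 0‖ ^ 2) := by
      intro y
      rw [hsplit, Finset.prod_insert, Finset.prod_insert]
      · simp
      · simp [B.fst_ne_snd g]
    by_cases h : x (B.fst g) = 0 ∧ x (B.snd g) = 0
    · rw [B.moment_cons_of_trivial hM hμ hnd.1 h.1 h.2, ih hnd.2 hd.2, hprod, h.1, h.2, hw0]
      simp [weight, h]
    · rw [B.moment_cons_of_nontrivial hM hq hμ hnd.1 h]
      have hterm : ∀ r : Fin (q ^ 2) × Fin (q ^ 2),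
          B.moment μ M gs (setPair x (B.fst g) (B.snd g) r) =
          ((gs.map (B.weight x)).prod *
          ∏ i ∈ Finset.univ.filter (fun i => ∀ g' ∈ g :: gs, i ≠ B.fst g' ∧ i ≠ B.snd g'),
            ‖M (x i) 0 0‖ ^ 2) * (‖M r.1 0 0‖ ^ 2 * ‖M r.2 0 0‖ ^ 2) := by
        intro r
        rw [ih hnd.2 hd.2, hprod, setPair_fst x (B.fst_ne_snd g), setPair_snd]
        have e1 : gs.map (B.weight (setPair x (B.fst g) (B.snd g) r)) = gs.map (B.weight x) := by
          refine List.map_congr_left fun g' hg' => ?_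
          have := hd.1 g' hg'
          rw [weight, weight, setPair_of_ne x r this.1.1.symm this.2.1.symm,
            setPair_of_ne x r this.1.2.symm this.2.2.symm]
        have e2 : ∏ i ∈ Finset.univ.filter (fun i => ∀ g' ∈ g :: gs, i ≠ B.fst g' ∧ i ≠ B.snd g'),
            ‖M (setPair x (B.fst g) (B.snd g) r i) 0 0‖ ^ 2 =
            ∏ i ∈ Finset.univ.filter (fun i => ∀ g' ∈ g :: gs, i ≠ B.fst g' ∧ i ≠ B.snd g'),
            ‖M (x i) 0 0‖ ^ 2 := by
          refine Finset.prod_congr rfl fun i hi => ?_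
          have := (Finset.mem_filter.mp hi).2 g (by simp)
          rw [setPair_of_ne x r this.1 this.2]
        rw [e1, e2]; ring
      simp only [hterm]
      rw [← Finset.mul_sum, Finset.sum_erase_eq_sub (Finset.mem_univ _)]
      have hs : ∑ r : Fin (q ^ 2) × Fin (q ^ 2), ‖M r.1 0 0‖ ^ 2 * ‖M r.2 0 0‖ ^ 2 =
          (q : ℝ) ^ 2 := by
        calc _ = (∑ a, ‖M a 0 0‖ ^ 2) * ∑ b, ‖M b 0 0‖ ^ 2 := by
              rw [Fintype.sum_prod_type, Finset.sum_mul_sum]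
          _ = _ := by rw [hM.sum_norm_sq_apply_zero, sq]
      rw [hs]
      have hz : ‖M (0 : Fin (q ^ 2) × Fin (q ^ 2)).1 0 0‖ ^ 2 *
          ‖M (0 : Fin (q ^ 2) × Fin (q ^ 2)).2 0 0‖ ^ 2 = 1 := by
        simp [hM.zero_eq_one]
      rw [hz]
      have hq2 : (2 : ℝ) ≤ q := by exact_mod_cast hq
      have hne : (q : ℝ) ^ 2 - 1 ≠ 0 := by nlinarith
      have hne' : (q : ℝ) ^ 2 + 1 ≠ 0 := by positivity
      simp only [List.map_cons, List.prod_cons, weight, if_neg h]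
      rw [show (q : ℝ) ^ 4 - 1 = (q ^ 2 - 1) * (q ^ 2 + 1) by ring]
      field_simp

theorem moment_of_covering (hM : IsOperatorBasis M) (hq : 2 ≤ q)
    (hμ : ∀ g, IsTwoDesign (μ g)) {gs : List Γ} (hnd : gs.Nodup) (hd : gs.Pairwise B.Disjoint)
    (hcov : ∀ i, ∃ g ∈ gs, i = B.fst g ∨ i = B.snd g) (x : Fin n → Fin (q ^ 2)) :
    B.moment μ M gs x = (gs.map (B.weight x)).prod := by
  rw [B.moment_of_pairwise_disjoint hM hq hμ hnd hd, Finset.filter_eq_empty_iff.mpr ?_,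
    Finset.prod_empty, mul_one]
  intro i _ hi
  obtain ⟨g, hg, h⟩ := hcov i
  exact h.elim (hi g hg).1 (hi g hg).2

/-- `x` vanishes outside of `A`. -/
def _root_.VariationalCircuit.SupportedOn (A : Set (Fin n)) (x : Fin n → Fin (q ^ 2)) : Prop :=
  ∀ i, x i ≠ 0 → i ∈ A

omit [NeZero q] in
theorem four_pow_sub_one_pos (hq : 2 ≤ q) : (0 : ℝ) < (q : ℝ) ^ 4 - 1 := by
  have hq2 : (2 : ℝ) ≤ q := by exact_mod_cast hq
  nlinarith [sq_nonneg ((q : ℝ) ^ 2 - 1)]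

theorem card_erase_zero :
    ((Finset.univ.erase (0 : Fin (q ^ 2) × Fin (q ^ 2))).card : ℝ) = (q : ℝ) ^ 4 - 1 := by
  rw [Finset.cast_card_erase_of_mem (Finset.mem_univ _)]
  simp
  ring

omit [Fintype Γ] [DecidableEq Γ] in
theorem supportedOn_setPair {A : Set (Fin n)} {g : Γ} (hA : B.fst g ∈ A ↔ B.snd g ∈ A)
    {x : Fin n → Fin (q ^ 2)} (hx : SupportedOn A x) (h : ¬ (x (B.fst g) = 0 ∧ x (B.snd g) = 0))
    (r : Fin (q ^ 2) × Fin (q ^ 2)) : SupportedOn A (setPair x (B.fst g) (B.snd g) r) := by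
  have h1 : B.fst g ∈ A := by
    by_contra h1
    refine h ⟨by_contra fun h2 => h1 (hx _ h2), by_contra fun h2 => h1 (hA.mpr (hx _ h2))⟩
  intro i hi
  by_cases e1 : i = B.fst g
  · exact e1 ▸ h1
  · by_cases e2 : i = B.snd g
    · exact e2 ▸ hA.mp h1
    · rw [setPair_of_ne x r e1 e2] at hi
      exact hx i hi

/-- If no block straddles the boundary of A, the chain never leaves A. An average of quantities that
are at least c is at least c. -/
theorem le_moment_append (hM : IsOperatorBasis M) (hq : 2 ≤ q)
    (hμ : ∀ g, IsTwoDesign (μ g)) {l gs : List Γ} (hnd : (l ++ gs).Nodup) {A : Set (Fin n)}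
    (hA : ∀ g ∈ l, B.fst g ∈ A ↔ B.snd g ∈ A) {c : ℝ}
    (hc : ∀ x, SupportedOn A x → c ≤ B.moment μ M gs x) (x : Fin n → Fin (q ^ 2))
    (hx : SupportedOn A x) : c ≤ B.moment μ M (l ++ gs) x := by
  induction l generalizing x with
  | nil => exact hc x hx
  | cons g l ih =>
    rw [List.cons_append, List.nodup_cons] at hnd
    rw [List.cons_append]
    have ih' := ih hnd.2 fun g' hg' => hA g' (List.mem_cons_of_mem _ hg')
    by_cases h : x (B.fst g) = 0 ∧ x (B.snd g) = 0
    · rw [B.moment_cons_of_trivial hM hμ hnd.1 h.1 h.2]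
      exact ih' x hx
    · rw [B.moment_cons_of_nontrivial hM hq hμ hnd.1 h, le_div_iff₀ (four_pow_sub_one_pos hq),
        ← card_erase_zero (q := q), mul_comm, ← nsmul_eq_mul]
      exact Finset.card_nsmul_le_sum _ _ _ fun r _ =>
        ih' _ (B.supportedOn_setPair (hA g (by simp)) hx h r)

/-- Of the q ^ 4 - 1 equally likely outcomes, q ^ 2 - 1 have the identity at p. Discarding the
others, which are nonnegative, leaves the fraction 1 / (q ^ 2 + 1). -/
theorem le_moment_cons_shrink (hM : IsOperatorBasis M) (hq : 2 ≤ q)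
    (hμ : ∀ g, IsTwoDesign (μ g)) {g : Γ} {gs : List Γ} (hg : g ∉ gs) {A : Set (Fin n)}
    (hA : B.fst g ∈ A ↔ B.snd g ∈ A) {p : Fin n} (hp : p = B.fst g ∨ p = B.snd g) {c : ℝ}
    (hc0 : 0 ≤ c) (hc : ∀ x, SupportedOn (A \ {p}) x → c ≤ B.moment μ M gs x)
    (x : Fin n → Fin (q ^ 2)) (hx : SupportedOn A x) :
    c / ((q : ℝ) ^ 2 + 1) ≤ B.moment μ M (g :: gs) x := by
  by_cases h : x (B.fst g) = 0 ∧ x (B.snd g) = 0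
  · rw [B.moment_cons_of_trivial hM hμ hg h.1 h.2]
    refine le_trans (div_le_self hc0 (by nlinarith [sq_nonneg (q : ℝ)])) (hc x fun i hi => ?_)
    refine ⟨hx i hi, fun e => hi ?_⟩
    rw [Set.mem_singleton_iff] at e
    rcases hp with hp | hp
    · rw [e, hp, h.1]
    · rw [e, hp, h.2]
  · rw [B.moment_cons_of_nontrivial hM hq hμ hg h]
    have hpos := four_pow_sub_one_pos hq
    -- The map f puts the identity on p and b on the partner site, whichever of the two sites of the
    -- block p is.
    obtain ⟨f, hf, hf0, hfp⟩ : ∃ f : Fin (q ^ 2) → Fin (q ^ 2) × Fin (q ^ 2),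
        Function.Injective f ∧ (∀ b, b ≠ 0 → f b ≠ 0) ∧
        ∀ b, setPair x (B.fst g) (B.snd g) (f b) p = 0 := by
      rcases hp with rfl | rfl
      · exact ⟨fun b => (0, b), fun a b h => (Prod.ext_iff.mp h).2,
          fun b hb h => hb (Prod.ext_iff.mp h).2, fun b => setPair_fst x (B.fst_ne_snd g) _⟩
      · exact ⟨fun b => (b, 0), fun a b h => (Prod.ext_iff.mp h).1,
          fun b hb h => hb (Prod.ext_iff.mp h).1, fun b => setPair_snd x _⟩
    have hsum : ((q : ℝ) ^ 2 - 1) * c ≤ ∑ r ∈ Finset.univ.erase (0 : Fin (q ^ 2) × Fin (q ^ 2)),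
        B.moment μ M gs (setPair x (B.fst g) (B.snd g) r) := by
      calc ((q : ℝ) ^ 2 - 1) * c = ∑ _b ∈ Finset.univ.erase (0 : Fin (q ^ 2)), c := by
            rw [Finset.sum_const, nsmul_eq_mul,
              Finset.cast_card_erase_of_mem (Finset.mem_univ _)]
            simp
        _ ≤ ∑ b ∈ Finset.univ.erase (0 : Fin (q ^ 2)),
            B.moment μ M gs (setPair x (B.fst g) (B.snd g) (f b)) := by
            refine Finset.sum_le_sum fun b _ => hc _ fun i hi => ?_
            refine ⟨B.supportedOn_setPair hA hx h _ i hi, fun e => hi ?_⟩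
            rw [Set.mem_singleton_iff.mp e, hfp]
        _ = ∑ r ∈ (Finset.univ.erase (0 : Fin (q ^ 2))).map ⟨f, hf⟩,
            B.moment μ M gs (setPair x (B.fst g) (B.snd g) r) := by
            rw [Finset.sum_map]; rfl
        _ ≤ _ := by
            refine Finset.sum_le_sum_of_subset_of_nonneg ?_ fun r _ _ => B.moment_nonneg _ _
            intro r hr
            obtain ⟨b, hb, rfl⟩ := Finset.mem_map.mp hr
            exact Finset.mem_erase.mpr ⟨hf0 b (Finset.ne_of_mem_erase hb), Finset.mem_univ _⟩
    rw [le_div_iff₀ hpos]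
    refine le_trans (le_of_eq ?_) hsum
    have : (q : ℝ) ^ 2 + 1 ≠ 0 := by positivity
    rw [show (q : ℝ) ^ 4 - 1 = (q ^ 2 - 1) * (q ^ 2 + 1) by ring]
    field_simp

theorem le_moment_append_shrink (hM : IsOperatorBasis M) (hq : 2 ≤ q)
    (hμ : ∀ g, IsTwoDesign (μ g)) {l gs : List Γ} (hnd : (l ++ gs).Nodup) {A : Set (Fin n)}
    (hA : ∀ g ∈ l, B.fst g ∈ A ↔ B.snd g ∈ A) {p : Fin n} {g₀ : Γ} (hg₀ : g₀ ∈ l)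
    (hp : p = B.fst g₀ ∨ p = B.snd g₀)
    (hp' : ∀ g ∈ l, p = B.fst g ∨ p = B.snd g → g = g₀) {c : ℝ}
    (hc0 : 0 ≤ c) (hc : ∀ x, SupportedOn (A \ {p}) x → c ≤ B.moment μ M gs x)
    (x : Fin n → Fin (q ^ 2)) (hx : SupportedOn A x) :
    c / ((q : ℝ) ^ 2 + 1) ≤ B.moment μ M (l ++ gs) x := by
  obtain ⟨l₁, l₂, rfl⟩ := List.append_of_mem hg₀
  rw [List.append_assoc] at hnd ⊢
  refine B.le_moment_append hM hq hμ hnd (fun g hg => hA g (by simp [hg])) ?_ x hx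
  have hnd2 := (List.nodup_append.mp hnd).2.1
  rw [List.cons_append, List.nodup_cons] at hnd2
  refine B.le_moment_cons_shrink hM hq hμ hnd2.1 (hA g₀ hg₀) hp hc0 ?_
  -- The blocks applied before g₀ in this layer do not touch p, so they preserve the reduced
  -- support; those peeled off earlier preserve A.
  refine B.le_moment_append hM hq hμ hnd2.2 (fun g hg => ?_) hc
  have hne : g ≠ g₀ := by
    rintro rfl
    exact hnd2.1 (List.mem_append_left _ hg)
  have hmem : g ∈ l₁ ++ g₀ :: l₂ := by simp [hg]
  have h1 : B.fst g ≠ p := fun e => hne (hp' g hmem (Or.inl e.symm))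
  have h2 : B.snd g ≠ p := fun e => hne (hp' g hmem (Or.inr e.symm))
  simp [hA g hmem, h1, h2]

end BlockFamily

/-! ### Geometry of the ring: gate pairs, arcs and parity -/

section Brickwork

variable {n : ℕ}

theorem sndSite_of_odd {τ : ℕ} (h : Odd τ) (j : Fin (n / 2)) :
    (sndSite τ j : ℕ) = 2 * (j : ℕ) + 1 := by
  simp [sndSite, h]

theorem sndSite_of_even {τ : ℕ} (h : ¬ Odd τ) (j : Fin (n / 2)) :
    (sndSite τ j : ℕ) = if (j : ℕ) = 0 then n - 1 else 2 * (j : ℕ) - 1 := by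
  have hj := j.isLt
  simp only [sndSite, if_neg h]
  split_ifs with h0
  · rw [h0, Nat.mod_eq_of_lt] <;> omega
  · rw [show 2 * (j : ℕ) + n - 1 = (2 * (j : ℕ) - 1) + n by omega, Nat.add_mod_right,
      Nat.mod_eq_of_lt (by omega)]

theorem fstSite_ne_sndSite (hn : Even n) (τ : ℕ) (j j' : Fin (n / 2)) :
    fstSite j ≠ sndSite τ j' := by
  intro h
  have h := congrArg Fin.val h
  have hj := j.isLt
  have hj' := j'.isLt
  obtain ⟨m, hm⟩ := hn
  by_cases hτ : Odd τ
  · rw [sndSite_of_odd hτ] at h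
    simp only [fstSite] at h
    omega
  · rw [sndSite_of_even hτ] at h
    simp only [fstSite] at h
    split_ifs at h <;> omega

theorem fstSite_injective : Function.Injective (fstSite : Fin (n / 2) → Fin n) := by
  intro j j' h
  have h := congrArg Fin.val h
  simp only [fstSite] at h
  exact Fin.ext (by omega)

theorem sndSite_injective (τ : ℕ) : Function.Injective (sndSite τ : Fin (n / 2) → Fin n) := by
  intro j j' h
  have h := congrArg Fin.val h
  have hj := j.isLt
  have hj' := j'.isLt
  refine Fin.ext ?_
  by_cases hτ : Odd τ
  · rw [sndSite_of_odd hτ, sndSite_of_odd hτ] at h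
    omega
  · rw [sndSite_of_even hτ, sndSite_of_even hτ] at h
    split_ifs at h <;> omega

/-- The sites `a, a + 1, …, a + m - 1` modulo `n`. -/
def arc (n a m : ℕ) : Set (Fin n) := {i | ∃ r < m, (i : ℕ) ≡ a + r [MOD n]}

theorem modEq_two_of_modEq (hn : Even n) {a b : ℕ} (h : a ≡ b [MOD n]) : a ≡ b [MOD 2] :=
  h.of_dvd hn.two_dvd

/-- An arc of even length that starts at the parity of the first site of a gate cannot cut the gate:
that site has even offset in the arc and its partner the next odd one. As n is even, parity makes
sense modulo n. -/
theorem mem_arc_iff_of_consecutive (hn : Even n) {a b p : ℕ} (hp : p ≡ a [MOD 2]) {i j : Fin n}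
    (hi : (i : ℕ) ≡ p [MOD n]) (hj : (j : ℕ) ≡ p + 1 [MOD n]) :
    i ∈ arc n a (2 * b) ↔ j ∈ arc n a (2 * b) := by
  constructor
  · rintro ⟨r, hr, h⟩
    have h1 : p ≡ a + r [MOD n] := hi.symm.trans h
    have h2 := modEq_two_of_modEq hn h1
    refine ⟨r + 1, ?_, hj.trans (h1.add_right 1)⟩
    unfold Nat.ModEq at h2 hp
    omega
  · rintro ⟨r, hr, h⟩
    have h1 : p + 1 ≡ a + r [MOD n] := hj.symm.trans h
    have h2 := modEq_two_of_modEq hn h1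
    unfold Nat.ModEq at h2 hp
    refine ⟨r - 1, by omega, hi.trans ?_⟩
    refine Nat.ModEq.add_right_cancel' 1 ?_
    rwa [show a + (r - 1) + 1 = a + r by omega]

theorem fstSite_mem_arc_iff (hn : Even n) {a b t : ℕ} (ha : a ≡ t [MOD 2]) (j : Fin (n / 2)) :
    fstSite j ∈ arc n a (2 * b) ↔ sndSite (t + 1) j ∈ arc n a (2 * b) := by
  have hj := j.isLt
  by_cases hτ : Odd (t + 1)
  · refine mem_arc_iff_of_consecutive hn (p := 2 * j) ?_ (Nat.ModEq.refl _) ?_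
    · unfold Nat.ModEq at *
      obtain ⟨m, hm⟩ := hτ
      omega
    · rw [sndSite_of_odd hτ]
  -- At even timesteps the second site of the gate precedes the first one on the ring; adding n
  -- keeps the subtraction honest when j = 0.
  · refine (mem_arc_iff_of_consecutive hn (p := 2 * j + n - 1) ?_ ?_ ?_).symm
    · unfold Nat.ModEq at *
      rw [Nat.not_odd_iff_even] at hτ
      obtain ⟨m, hm⟩ := hτ
      obtain ⟨m', hm'⟩ := hn
      omega
    · simp only [sndSite, if_neg hτ]
      exact Nat.mod_modEq _ _
    · rw [show 2 * (j : ℕ) + n - 1 + 1 = 2 * j + n by omega]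
      simp [fstSite, Nat.ModEq]

theorem exists_site_eq (hn : Even n) (hn0 : 0 < n) {a t : ℕ} (ha : a ≡ t [MOD 2]) :
    ∃ j : Fin (n / 2), (⟨a % n, Nat.mod_lt _ hn0⟩ : Fin n) = fstSite j ∨
      (⟨a % n, Nat.mod_lt _ hn0⟩ : Fin n) = sndSite (t + 1) j := by
  have h1 := modEq_two_of_modEq hn (Nat.mod_modEq a n)
  have h2 := Nat.mod_lt a hn0
  unfold Nat.ModEq at h1 ha
  by_cases hτ : Odd (t + 1)
  · have hτ' := hτ
    obtain ⟨m, hm⟩ := hτ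
    obtain ⟨m', hm'⟩ := hn
    refine ⟨⟨a % n / 2, by omega⟩, Or.inl (Fin.ext ?_)⟩
    simp only [fstSite]
    omega
  · have hτ' := hτ
    rw [Nat.not_odd_iff_even] at hτ'
    obtain ⟨m, hm⟩ := hτ'
    obtain ⟨m', hm'⟩ := hn
    by_cases h3 : a % n = n - 1
    · refine ⟨⟨0, by omega⟩, Or.inr (Fin.ext ?_)⟩
      rw [sndSite_of_even hτ]
      simpa using h3
    · refine ⟨⟨(a % n + 1) / 2, by omega⟩, Or.inr (Fin.ext ?_)⟩
      rw [sndSite_of_even hτ]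
      dsimp only
      split_ifs <;> omega

/-- The length is kept rather than reduced by one: the translated arc is again even and has the
parity required by the preceding layer. -/
theorem arc_diff_subset (hn0 : 0 < n) (a m : ℕ) :
    arc n a m \ {⟨a % n, Nat.mod_lt _ hn0⟩} ⊆ arc n (a + 1) m := by
  rintro i ⟨⟨r, hr, h⟩, hi⟩
  have hr0 : r ≠ 0 := by
    rintro rfl
    refine hi (Fin.ext ?_)
    have : (i : ℕ) % n = (a + 0) % n := h
    rwa [Nat.mod_eq_of_lt i.isLt, add_zero] at this
  exact ⟨r - 1, by omega, by rwa [show a + 1 + (r - 1) = a + r by omega]⟩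

end Brickwork

/-- The blocks of a brickwork circuit, with fixed unitaries around the random gates. -/
structure BrickworkFamily (q n d : ℕ) extends BlockFamily q n (GateIdx n d) where
  fst_eq : ∀ g, fst g = fstSite g.2
  snd_eq : ∀ g, snd g = sndSite (g.1 + 1) g.2

/-- The gates of timestep `t + 1`. -/
def layerGates (n : ℕ) {d : ℕ} (t : Fin d) : List (GateIdx n d) :=
  List.ofFn fun j : Fin (n / 2) => (t, j)

/-- The gates of the first `m` timesteps, the latest layer first. -/
def gatesUpTo (n d : ℕ) : ℕ → List (GateIdx n d)
  | 0 => []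
  | m + 1 => (if h : m < d then layerGates n ⟨m, h⟩ else []) ++ gatesUpTo n d m

theorem gatesUpTo_succ {n d m : ℕ} (h : m < d) :
    gatesUpTo n d (m + 1) = layerGates n ⟨m, h⟩ ++ gatesUpTo n d m := by
  simp [gatesUpTo, h]

theorem mem_layerGates {n d : ℕ} {t : Fin d} {g : GateIdx n d} :
    g ∈ layerGates n t ↔ g.1 = t := by
  simp only [layerGates, List.mem_ofFn]
  constructor
  · rintro ⟨j, rfl⟩; rfl
  · rintro rfl; exact ⟨g.2, rfl⟩

theorem lt_of_mem_gatesUpTo {n d m : ℕ} {g : GateIdx n d} (hg : g ∈ gatesUpTo n d m) :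
    (g.1 : ℕ) < m := by
  induction m with
  | zero => simp [gatesUpTo] at hg
  | succ m ih =>
    rw [gatesUpTo, List.mem_append] at hg
    rcases hg with hg | hg
    · split_ifs at hg with h
      · rw [mem_layerGates.mp hg]; simp
      · simp at hg
    · exact (ih hg).trans (Nat.lt_succ_self m)

theorem nodup_layerGates {n d : ℕ} (t : Fin d) : (layerGates n t).Nodup :=
  List.nodup_ofFn.mpr fun _ _ h => (Prod.ext_iff.mp h).2

theorem nodup_gatesUpTo (n d m : ℕ) : (gatesUpTo n d m).Nodup := by
  induction m with
  | zero => simp [gatesUpTo]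
  | succ m ih =>
    rw [gatesUpTo]
    refine List.Nodup.append ?_ ih ?_
    · split_ifs
      · exact nodup_layerGates _
      · simp
    · intro g h1 h2
      have := lt_of_mem_gatesUpTo h2
      split_ifs at h1 with h
      · rw [mem_layerGates.mp h1] at this
        simp at this
      · simp at h1

/-! ### Lower bounds for brickwork circuits with frozen parameters -/

namespace BrickworkFamily

variable {q n d : ℕ} [NeZero q] (B : BrickworkFamily q n d)
  {μ : GateIdx n d → Measure (Matrix.unitaryGroup (Fin q × Fin q) ℂ)}
  {M : Fin (q ^ 2) → Matrix (Fin q) (Fin q) ℂ}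

omit [NeZero q] in
theorem disjoint_of_ne (hn : Even n) {g g' : GateIdx n d} (ht : g.1 = g'.1) (h : g ≠ g') :
    B.Disjoint g g' := by
  have hj : g.2 ≠ g'.2 := fun e => h (Prod.ext ht e)
  unfold BlockFamily.Disjoint
  rw [B.fst_eq, B.fst_eq, B.snd_eq, B.snd_eq, ht]
  exact ⟨⟨fun e => hj (fstSite_injective e), fstSite_ne_sndSite hn _ _ _⟩,
    (fstSite_ne_sndSite hn _ _ _).symm, fun e => hj (sndSite_injective _ e)⟩

theorem moment_first_layer (hn : Even n) (hM : IsOperatorBasis M) (hq : 2 ≤ q)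
    (hμ : ∀ g, IsTwoDesign (μ g)) (h : 0 < d) (x : Fin n → Fin (q ^ 2)) :
    B.moment μ M (gatesUpTo n d 1) x = (1 / ((q : ℝ) ^ 2 + 1)) ^
      (Finset.univ.filter fun j : Fin (n / 2) =>
        ¬ (x (B.fst (⟨0, h⟩, j)) = 0 ∧ x (B.snd (⟨0, h⟩, j)) = 0)).card := by
  have hg : gatesUpTo n d 1 = layerGates n ⟨0, h⟩ := by simp [gatesUpTo, h]
  rw [hg, B.moment_of_covering hM hq hμ (nodup_layerGates _)]
  · rw [layerGates, List.map_ofFn, List.prod_ofFn]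
    simp only [Function.comp_def, BlockFamily.weight]
    rw [Finset.prod_ite, Finset.prod_const_one, one_mul, Finset.prod_const]
  · refine List.Pairwise.imp_of_mem ?_ (nodup_layerGates (n := n) (⟨0, h⟩ : Fin d))
    intro g g' h1 h2 hne
    exact B.disjoint_of_ne hn ((mem_layerGates.mp h1).trans (mem_layerGates.mp h2).symm) hne
  · intro i
    have hlt := i.isLt
    obtain ⟨m, hm⟩ := hn
    refine ⟨(⟨0, h⟩, ⟨(i : ℕ) / 2, by omega⟩), mem_layerGates.mpr rfl, ?_⟩
    rw [B.fst_eq, B.snd_eq]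
    by_cases hi2 : (i : ℕ) % 2 = 0
    · exact Or.inl (Fin.ext (by simp only [fstSite]; omega))
    · refine Or.inr (Fin.ext ?_)
      rw [sndSite_of_odd (by simp)]
      dsimp only
      omega

theorem inv_pow_le_moment (hn : Even n) (hM : IsOperatorBasis M) (hq : 2 ≤ q)
    (hμ : ∀ g, IsTwoDesign (μ g)) {t : ℕ} (ht : t < d) (x : Fin n → Fin (q ^ 2)) :
    1 / ((q : ℝ) + 1) ^ n ≤ B.moment μ M (gatesUpTo n d (t + 1)) x := by
  induction t generalizing x with
  | zero =>
    rw [zero_add, B.moment_first_layer hn hM hq hμ ht]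
    have hle : (1 : ℝ) ≤ (q : ℝ) ^ 2 + 1 := by nlinarith [sq_nonneg (q : ℝ)]
    have hcard := Finset.card_filter_le (Finset.univ : Finset (Fin (n / 2))) fun j =>
        ¬ (x (B.fst (⟨0, ht⟩, j)) = 0 ∧ x (B.snd (⟨0, ht⟩, j)) = 0)
    rw [Finset.card_univ, Fintype.card_fin] at hcard
    rw [_root_.one_div_pow]
    refine one_div_le_one_div_of_le (by positivity) ((pow_le_pow_right₀ hle hcard).trans ?_)
    have hn2 : n = 2 * (n / 2) := by obtain ⟨m, hm⟩ := hn; omega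
    conv_rhs => rw [hn2, pow_mul]
    refine pow_le_pow_left₀ (by positivity) ?_ _
    have : (0 : ℝ) ≤ q := Nat.cast_nonneg q
    nlinarith
  | succ t ih =>
    have hnd := nodup_gatesUpTo n d (t + 1 + 1)
    rw [gatesUpTo_succ ht] at hnd ⊢
    -- With no restriction on the support, later layers only average a bound valid for all strings.
    exact B.le_moment_append hM hq hμ hnd (A := Set.univ) (by simp)
      (fun x _ => ih (by omega) x) x fun i _ => Set.mem_univ i

/-- Each layer after the first costs one factor 1 / (q ^ 2 + 1), the price of translating the arc
into alignment with the layer before. The first layer costs at most one factor for each of the b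
gates in the arc. -/
theorem arc_pow_le_moment (hn : Even n) (hn0 : 0 < n) (hM : IsOperatorBasis M) (hq : 2 ≤ q)
    (hμ : ∀ g, IsTwoDesign (μ g)) (b : ℕ) {t : ℕ} (ht : t < d) {a : ℕ} (ha : a ≡ t [MOD 2])
    (x : Fin n → Fin (q ^ 2)) (hx : SupportedOn (arc n a (2 * b)) x) :
    1 / ((q : ℝ) ^ 2 + 1) ^ (b + t) ≤ B.moment μ M (gatesUpTo n d (t + 1)) x := by
  induction t generalizing x a with
  | zero =>
    rw [zero_add, B.moment_first_layer hn hM hq hμ ht, _root_.one_div_pow, add_zero]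
    have hle : (1 : ℝ) ≤ (q : ℝ) ^ 2 + 1 := by nlinarith [sq_nonneg (q : ℝ)]
    refine one_div_le_one_div_of_le (by positivity) (pow_le_pow_right₀ hle ?_)
    -- A nontrivial gate lies wholly in the arc and its first site has an even offset 2r there, so r
    -- injects these gates into `Finset.range b`.
    have hr : ∀ j : Fin (n / 2), ¬ (x (B.fst (⟨0, ht⟩, j)) = 0 ∧ x (B.snd (⟨0, ht⟩, j)) = 0) →
        ∃ r < b, 2 * (j : ℕ) ≡ a + 2 * r [MOD n] := by
      intro j hj
      have hmem : fstSite j ∈ arc n a (2 * b) := by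
        rw [B.fst_eq, B.snd_eq] at hj
        by_contra hcon
        refine hj ⟨by_contra fun h => hcon (hx _ h), by_contra fun h => hcon ?_⟩
        exact (fstSite_mem_arc_iff hn ha j).mpr (hx _ h)
      obtain ⟨r, hr, h⟩ := hmem
      have h2 := modEq_two_of_modEq hn h
      simp only [fstSite] at h h2
      unfold Nat.ModEq at h2 ha
      refine ⟨r / 2, by omega, ?_⟩
      rwa [show 2 * (r / 2) = r by omega]
    choose! f hf hf' using hr
    rw [← Finset.card_range b]
    refine Finset.card_le_card_of_injOn f (fun j hj => ?_) ?_
    · simpa using hf j (Finset.mem_filter.mp hj).2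
    · intro j hj j' hj' e
      have h1 := hf' j (Finset.mem_filter.mp hj).2
      have h2 := hf' j' (Finset.mem_filter.mp hj').2
      rw [e] at h1
      have h3 := Nat.ModEq.eq_of_lt_of_lt (h1.trans h2.symm) (by omega) (by omega)
      exact Fin.ext (by omega)
  | succ t ih =>
    have hnd := nodup_gatesUpTo n d (t + 1 + 1)
    rw [gatesUpTo_succ ht] at hnd ⊢
    -- The gate containing the left end of the arc; it is the one asked to leave the identity there.
    obtain ⟨j, hj⟩ := exists_site_eq hn hn0 ha
    have h := B.le_moment_append_shrink hM hq hμ hnd (A := arc n a (2 * b))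
      (p := ⟨a % n, Nat.mod_lt _ hn0⟩) (g₀ := (⟨t + 1, ht⟩, j))
      (c := 1 / ((q : ℝ) ^ 2 + 1) ^ (b + t)) ?_ (mem_layerGates.mpr rfl) ?_ ?_ (by positivity)
      ?_ x hx
    · refine le_trans (le_of_eq ?_) h
      rw [div_div, ← pow_succ]; rfl
    · intro g hg
      rw [B.fst_eq, B.snd_eq, mem_layerGates.mp hg]
      exact fstSite_mem_arc_iff hn ha g.2
    · rw [B.fst_eq, B.snd_eq]; exact hj
    · intro g hg hp
      by_contra hne
      have hd := B.disjoint_of_ne hn (g := g) (g' := (⟨t + 1, ht⟩, j)) (mem_layerGates.mp hg) hne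
      have hj' : (⟨a % n, Nat.mod_lt _ hn0⟩ : Fin n) = B.fst (⟨t + 1, ht⟩, j) ∨
          (⟨a % n, Nat.mod_lt _ hn0⟩ : Fin n) = B.snd (⟨t + 1, ht⟩, j) := by
        rw [B.fst_eq, B.snd_eq]; exact hj
      rcases hp with hp | hp <;> rcases hj' with hj' | hj'
      · exact hd.1.1 (hp.symm.trans hj')
      · exact hd.1.2 (hp.symm.trans hj')
      · exact hd.2.1 (hp.symm.trans hj')
      · exact hd.2.2 (hp.symm.trans hj')
    · intro y hy
      refine ih (by omega) (a := a + 1) ?_ y fun i hi => arc_diff_subset hn0 a _ (hy i hi)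
      unfold Nat.ModEq at ha ⊢
      omega

/-- Both lower bounds on the second moment of a spatially `k`-local operator. -/
theorem max_le_moment (hn : Even n) (hM : IsOperatorBasis M) (hq : 2 ≤ q)
    (hμ : ∀ g, IsTwoDesign (μ g)) (hd : 1 ≤ d) {k : ℕ} (x : Fin n → Fin (q ^ 2))
    (hx : IsSpatiallyLocal k x) :
    max (1 / ((q : ℝ) + 1) ^ k * (1 / ((q : ℝ) ^ 2 + 1) ^ (d + 1))) (1 / ((q : ℝ) + 1) ^ n) ≤
      B.moment μ M (gatesUpTo n d d) x := by
  obtain ⟨t, rfl⟩ : ∃ t, d = t + 1 := ⟨d - 1, by omega⟩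
  have hq0 : (0 : ℝ) ≤ q := Nat.cast_nonneg q
  have hle1 : (1 : ℝ) ≤ (q : ℝ) + 1 := by linarith
  have hle2 : (1 : ℝ) ≤ (q : ℝ) ^ 2 + 1 := by nlinarith
  have hgen := B.inv_pow_le_moment hn hM hq hμ (Nat.lt_succ_self t) x
  refine max_le ?_ hgen
  -- On the empty ring there is no site for an arc to start at, but the general bound is already 1.
  rcases Nat.eq_zero_or_pos n with rfl | hn0
  · refine le_trans ?_ hgen
    rw [pow_zero, div_one]
    refine mul_le_one₀ ?_ (by positivity) ?_
    · exact (div_le_one (by positivity)).mpr (one_le_pow₀ hle1)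
    · exact (div_le_one (by positivity)).mpr (one_le_pow₀ hle2)
  · obtain ⟨a, ha⟩ := hx
    -- If the parity of a is wrong, the arc starts one site earlier, written a + n - 1. The length 2
    -- (k / 2 + 1) is at least k + 1, which leaves room for the extra site.
    obtain ⟨a', ha', hsup⟩ : ∃ a', a' ≡ t [MOD 2] ∧ SupportedOn (arc n a' (2 * (k / 2 + 1))) x := by
      by_cases hpar : a ≡ t [MOD 2]
      · refine ⟨a, hpar, fun i hi => ?_⟩
        obtain ⟨r, hr, h⟩ := ha i hi
        exact ⟨r, by omega, by rw [h]; exact Nat.mod_modEq _ _⟩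
      · refine ⟨a + n - 1, ?_, fun i hi => ?_⟩
        · obtain ⟨m, hm⟩ := hn
          unfold Nat.ModEq at hpar ⊢
          omega
        · obtain ⟨r, hr, h⟩ := ha i hi
          refine ⟨r + 1, by omega, ?_⟩
          rw [h, show a + n - 1 + (r + 1) = a + r + n by omega]
          exact (Nat.mod_modEq _ _).trans (by simp [Nat.ModEq])
    refine le_trans ?_ (B.arc_pow_le_moment hn hn0 hM hq hμ _ (Nat.lt_succ_self t) ha' x hsup)
    rw [one_div_mul_one_div]
    refine one_div_le_one_div_of_le (by positivity) ?_
    -- Only d factors beyond k / 2 are used; the exponent d + 1 of the claim has one to spare.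
    rw [show k / 2 + 1 + t = k / 2 + (t + 1) by ring, pow_add]
    refine mul_le_mul ?_ (pow_le_pow_right₀ hle2 (by omega)) (by positivity) (by positivity)
    calc ((q : ℝ) ^ 2 + 1) ^ (k / 2) ≤ (((q : ℝ) + 1) ^ 2) ^ (k / 2) :=
          pow_le_pow_left₀ (by positivity) (by nlinarith) _
      _ = ((q : ℝ) + 1) ^ (2 * (k / 2)) := by rw [pow_mul]
      _ ≤ _ := pow_le_pow_right₀ hle1 (by omega)

end BrickworkFamily

/-! ### Parameterized gates and the average over the parameters -/

theorem ParamGate.eval_mem_unitaryGroup {q : ℕ} (P : ParamGate q) (θ : ℝ) :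
    P.eval θ ∈ Matrix.unitaryGroup (Fin q × Fin q) ℂ := by
  refine mul_mem (mul_mem P.Wl.2 ?_) P.Wr.2
  rw [Matrix.mem_unitaryGroup_iff, Matrix.star_eq_conjTranspose, ← Matrix.exp_conjTranspose]
  have h : (-(Complex.I * (θ : ℂ)) • P.A)ᴴ = -(-(Complex.I * (θ : ℂ)) • P.A) := by
    rw [Matrix.conjTranspose_smul, P.isHermitian.eq]
    simp
  rw [h, Matrix.exp_neg, Matrix.mul_nonsing_inv]
  exact (Matrix.isUnit_iff_isUnit_det _).mp (Matrix.isUnit_exp _)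

theorem ParamGate.continuous_eval {q : ℕ} (P : ParamGate q) : Continuous P.eval := by
  have h : Continuous (NormedSpace.exp : PairOp q → PairOp q) := by
    let _ : NormedRing (PairOp q) := Matrix.linftyOpNormedRing
    let _ : NormedAlgebra ℂ (PairOp q) := Matrix.linftyOpNormedAlgebra
    let _ : NormedAlgebra ℚ (PairOp q) := NormedAlgebra.restrictScalars ℚ ℂ (PairOp q)
    exact NormedSpace.exp_continuous
  unfold ParamGate.eval
  refine (continuous_const.mul (h.comp ?_)).mul continuous_const
  fun_prop

namespace BrickworkAnsatz

variable {q n d : ℕ}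

/-- The blocks of the ansatz at fixed parameter values. -/
def family (𝒜 : BrickworkAnsatz q n d) (hn : Even n) (θ : 𝒜.ParamIdx → ℝ) :
    BrickworkFamily q n d where
  fst g := fstSite g.2
  snd g := sndSite (g.1 + 1) g.2
  fst_ne_snd _ := fstSite_ne_sndSite hn _ _ _
  post g := ⟨(List.ofFn fun l => (𝒜.post g l).eval (θ (Sum.inr ⟨g, l⟩))).reverse.prod, by
    refine list_prod_mem fun G hG => ?_
    rw [List.mem_reverse, List.mem_ofFn] at hG
    obtain ⟨l, rfl⟩ := hG
    exact ParamGate.eval_mem_unitaryGroup _ _⟩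
  pre g := ⟨(List.ofFn fun l => (𝒜.pre g l).eval (θ (Sum.inl ⟨g, l⟩))).reverse.prod, by
    refine list_prod_mem fun G hG => ?_
    rw [List.mem_reverse, List.mem_ofFn] at hG
    obtain ⟨l, rfl⟩ := hG
    exact ParamGate.eval_mem_unitaryGroup _ _⟩
  fst_eq _ := rfl
  snd_eq _ := rfl

theorem layer_eq_circ (𝒜 : BrickworkAnsatz q n d) (hn : Even n)
    (V : GateIdx n d → Matrix.unitaryGroup (Fin q × Fin q) ℂ) (θ : 𝒜.ParamIdx → ℝ) (t : Fin d) :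
    𝒜.layer V θ t = (𝒜.family hn θ).circ (layerGates n t) V := by
  rw [layer, BlockFamily.circ, layerGates, List.map_ofFn]
  rfl

theorem circuit_eq_circ (𝒜 : BrickworkAnsatz q n d) (hn : Even n)
    (V : GateIdx n d → Matrix.unitaryGroup (Fin q × Fin q) ℂ) (θ : 𝒜.ParamIdx → ℝ) :
    𝒜.circuit V θ = (𝒜.family hn θ).circ (gatesUpTo n d d) V := by
  -- The identity is proved for the first m timesteps so that induction can add the latest layer on
  -- the left.
  have key : ∀ m (hm : m ≤ d), (List.ofFn fun t : Fin m => 𝒜.layer V θ (t.castLE hm)).reverse.prod =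
      (𝒜.family hn θ).circ (gatesUpTo n d m) V := by
    intro m
    induction m with
    | zero => intro _; simp [gatesUpTo, BlockFamily.circ]
    | succ m ih =>
      intro hm
      rw [List.ofFn_succ', List.concat_eq_append, List.reverse_append, List.prod_append,
        gatesUpTo_succ hm, BlockFamily.circ, List.map_append, List.prod_append]
      refine congrArg₂ (· * ·) ?_ (ih (by omega))
      rw [List.reverse_singleton, List.prod_singleton, 𝒜.layer_eq_circ hn]
      rfl
  exact key d le_rfl

theorem circuit_mem_unitaryGroup (𝒜 : BrickworkAnsatz q n d) (hn : Even n)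
    (V : GateIdx n d → Matrix.unitaryGroup (Fin q × Fin q) ℂ) (θ : 𝒜.ParamIdx → ℝ) :
    𝒜.circuit V θ ∈ Matrix.unitaryGroup (Fin n → Fin q) ℂ := by
  rw [𝒜.circuit_eq_circ hn]
  refine list_prod_mem fun G hG => ?_
  obtain ⟨g, -, rfl⟩ := List.mem_map.mp hG
  exact onPair_mem_unitaryGroup ((𝒜.family hn θ).fst_ne_snd g)
    (mul_mem (mul_mem ((𝒜.family hn θ).post g).2 (V g).2) ((𝒜.family hn θ).pre g).2)

theorem continuous_list_ofFn_prod {X R : Type*} [TopologicalSpace X] [TopologicalSpace R]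
    [Monoid R] [ContinuousMul R] {m : ℕ} {f : Fin m → X → R} (hf : ∀ l, Continuous (f l)) :
    Continuous fun x => (List.ofFn fun l => f l x).prod := by
  simp only [List.ofFn_eq_map]
  exact continuous_list_prod _ fun l _ => hf l

theorem continuous_list_ofFn_reverse_prod {X R : Type*} [TopologicalSpace X] [TopologicalSpace R]
    [Monoid R] [ContinuousMul R] {m : ℕ} {f : Fin m → X → R} (hf : ∀ l, Continuous (f l)) :
    Continuous fun x => (List.ofFn fun l => f l x).reverse.prod := by
  simp only [List.ofFn_eq_map, ← List.map_reverse]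
  exact continuous_list_prod _ fun l _ => hf l

theorem continuous_circuit (𝒜 : BrickworkAnsatz q n d) :
    Continuous fun p : (GateIdx n d → Matrix.unitaryGroup (Fin q × Fin q) ℂ) ×
      (𝒜.ParamIdx → ℝ) => 𝒜.circuit p.1 p.2 := by
  unfold circuit layer block
  refine continuous_list_ofFn_reverse_prod fun t => continuous_list_ofFn_prod fun j =>
    (continuous_onPair _ _).comp (Continuous.mul (Continuous.mul ?_ ?_) ?_)
  · exact continuous_list_ofFn_reverse_prod fun l => (ParamGate.continuous_eval _).comp
      ((continuous_apply _).comp continuous_snd)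
  · exact continuous_subtype_val.comp ((continuous_apply _).comp continuous_fst)
  · exact continuous_list_ofFn_reverse_prod fun l => (ParamGate.continuous_eval _).comp
      ((continuous_apply _).comp continuous_snd)

variable [NeZero q]

theorem expval_eq (𝒜 : BrickworkAnsatz q n d)
    (V : GateIdx n d → Matrix.unitaryGroup (Fin q × Fin q) ℂ) (θ : 𝒜.ParamIdx → ℝ) (O : Op q n) :
    𝒜.expval V θ O = star (𝒜.circuit V θ *ᵥ zeroKet q n) ⬝ᵥ
      (O *ᵥ (𝒜.circuit V θ *ᵥ zeroKet q n)) := by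
  rw [expval, Matrix.star_mulVec, ← Matrix.dotProduct_mulVec, Matrix.mulVec_mulVec,
    Matrix.mulVec_mulVec, Matrix.mul_assoc]

theorem norm_expval_le (𝒜 : BrickworkAnsatz q n d) (hn : Even n)
    (V : GateIdx n d → Matrix.unitaryGroup (Fin q × Fin q) ℂ) (θ : 𝒜.ParamIdx → ℝ) (O : Op q n) :
    ‖𝒜.expval V θ O‖ ≤ ∑ s, ∑ t, ‖O s t‖ := by
  have hψ : ∀ s, ‖(𝒜.circuit V θ *ᵥ zeroKet q n) s‖ ≤ 1 := by
    intro s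
    rw [zeroKet, Matrix.mulVec_single_one]
    exact entry_norm_bound_of_unitary (𝒜.circuit_mem_unitaryGroup hn V θ) s _
  rw [expval_eq, dotProduct]
  refine (norm_sum_le _ _).trans (Finset.sum_le_sum fun s _ => ?_)
  rw [norm_mul, Pi.star_apply, norm_star]
  refine (mul_le_of_le_one_left (norm_nonneg _) (hψ s)).trans ?_
  rw [Matrix.mulVec, dotProduct]
  refine (norm_sum_le _ _).trans (Finset.sum_le_sum fun t _ => ?_)
  rw [norm_mul]
  exact mul_le_of_le_one_right (norm_nonneg _) (hψ t)

theorem continuous_norm_expval_sq (𝒜 : BrickworkAnsatz q n d) (O : Op q n) :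
    Continuous fun p : (GateIdx n d → Matrix.unitaryGroup (Fin q × Fin q) ℂ) ×
      (𝒜.ParamIdx → ℝ) => ‖𝒜.expval p.1 p.2 O‖ ^ 2 := by
  simp only [expval_eq]
  have h := 𝒜.continuous_circuit.matrix_mulVec (continuous_const (y := zeroKet q n))
  exact ((h.star.dotProduct (continuous_const.matrix_mulVec h)).norm).pow 2

/-- Fubini exchanges the two averages, so that the gates are integrated first at fixed θ, where the
recursion applies. -/
theorem le_gVal (𝒜 : BrickworkAnsatz q n d) (hn : Even n)
    {μ : GateIdx n d → Measure (Matrix.unitaryGroup (Fin q × Fin q) ℂ)}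
    (hμ : ∀ g, IsTwoDesign (μ g)) (M : Fin (q ^ 2) → Matrix (Fin q) (Fin q) ℂ)
    (x : Fin n → Fin (q ^ 2)) {c : ℝ}
    (hc : ∀ θ, c ≤ (𝒜.family hn θ).moment μ M (gatesUpTo n d d) x) : c ≤ 𝒜.gVal μ M x := by
  have := fun g => (hμ g).isProbabilityMeasure
  have hcond : IsProbabilityMeasure
      (ProbabilityTheory.cond volume (Set.Icc (0 : ℝ) (2 * Real.pi))) := by
    refine ProbabilityTheory.cond_isProbabilityMeasure_of_finite ?_ ?_
    · simp [Real.pi_pos]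
    · exact isCompact_Icc.measure_lt_top.ne
  unfold gVal
  set ν := Measure.pi fun _ : 𝒜.ParamIdx =>
    ProbabilityTheory.cond volume (Set.Icc (0 : ℝ) (2 * Real.pi)) with hν
  have hint : Integrable (Function.uncurry fun V θ => ‖𝒜.expval V θ (tensorOp M x)‖ ^ 2)
      ((Measure.pi μ).prod ν) := by
    -- The parameter space is not compact, so continuity alone is not enough; unitarity bounds the
    -- integrand uniformly.
    refine Integrable.of_bound (𝒜.continuous_norm_expval_sq _).aestronglyMeasurable
      ((∑ s, ∑ t, ‖tensorOp M x s t‖) ^ 2) (Filter.Eventually.of_forall fun p => ?_)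
    rw [Function.uncurry, Real.norm_of_nonneg (by positivity)]
    exact pow_le_pow_left₀ (norm_nonneg _) (𝒜.norm_expval_le hn _ _ _) 2
  rw [integral_integral_swap hint]
  have hm : ∀ θ, ∫ V, ‖𝒜.expval V θ (tensorOp M x)‖ ^ 2 ∂(Measure.pi μ) =
      (𝒜.family hn θ).moment μ M (gatesUpTo n d d) x := by
    intro θ
    simp only [expval_eq, 𝒜.circuit_eq_circ hn]
    rfl
  calc c = ∫ _θ, c ∂ν := by simp
    _ ≤ _ := integral_mono (integrable_const c) hint.integral_prod_right fun θ => by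
      exact (hc θ).trans_eq (hm θ).symm

end BrickworkAnsatz

theorem rpow_neg_le_lower_bound {q d k : ℕ} (hq : 2 ≤ q) (hd : 1 ≤ d) :
    (q : ℝ) ^ (-((6 : ℝ) * ((d : ℝ) + (k : ℝ)))) ≤
      1 / ((q : ℝ) + 1) ^ k * (1 / ((q : ℝ) ^ 2 + 1) ^ (d + 1)) := by
  have hq2 : (2 : ℝ) ≤ q := by exact_mod_cast hq
  rw [Real.rpow_neg (by positivity), one_div_mul_one_div, ← one_div,
    show (6 : ℝ) * ((d : ℝ) + (k : ℝ)) = ((6 * (d + k) : ℕ) : ℝ) by push_cast; ring,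
    Real.rpow_natCast]
  refine one_div_le_one_div_of_le (by positivity) ?_
  -- For q ≥ 2 one has q + 1 ≤ q ^ 2 and q ^ 2 + 1 ≤ q ^ 3. Since d ≥ 1, 2k + 3 (d + 1) ≤ 6 (d + k),
  -- whence the constant 6.
  calc ((q : ℝ) + 1) ^ k * ((q : ℝ) ^ 2 + 1) ^ (d + 1)
      ≤ ((q : ℝ) ^ 2) ^ k * ((q : ℝ) ^ 3) ^ (d + 1) := by
        gcongr
        · nlinarith
        · nlinarith [sq_nonneg (q : ℝ)]
    _ = (q : ℝ) ^ (2 * k + 3 * (d + 1)) := by rw [← pow_mul, ← pow_mul, ← pow_add]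
    _ ≤ _ := pow_le_pow_right₀ (by linarith) (by omega)

end

end VariationalCircuit

theorem corollary4 :
    ∃ C : ℝ, 0 < C ∧
      ∀ (q n d k : ℕ) [NeZero q], 2 ≤ q → Even n → 1 ≤ d →
      ∀ (𝒜 : VariationalCircuit.BrickworkAnsatz q n d)
        (μ : VariationalCircuit.GateIdx n d →
          MeasureTheory.Measure (Matrix.unitaryGroup (Fin q × Fin q) ℂ)),
        (∀ g, VariationalCircuit.IsTwoDesign (μ g)) →
      ∀ M : Fin (q ^ 2) → Matrix (Fin q) (Fin q) ℂ, VariationalCircuit.IsOperatorBasis M →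
      ∀ x : Fin n → Fin (q ^ 2), VariationalCircuit.IsSpatiallyLocal k x →
        max ((q : ℝ) ^ (-(C * ((d : ℝ) + (k : ℝ))))) (1 / ((q : ℝ) + 1) ^ n) ≤ 𝒜.gVal μ M x ∧
        max (1 / ((q : ℝ) + 1) ^ k * (1 / ((q : ℝ) ^ 2 + 1) ^ (d + 1))) (1 / ((q : ℝ) + 1) ^ n) ≤
          𝒜.gVal μ M x := by
  refine ⟨6, by norm_num, ?_⟩
  intro q n d k _ hq hn hd 𝒜 μ hμ M hM x hx
  have h := 𝒜.le_gVal hn hμ M x fun θ => (𝒜.family hn θ).max_le_moment hn hM hq hμ hd x hx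
  exact ⟨(max_le_max_right _ (VariationalCircuit.rpow_neg_le_lower_bound hq hd)).trans h, h⟩
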